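/- Let $k$ be a field and let $0\le t\le n$ be integers. Let $N_1,\dots,N_t$ be integers greater than $1$, and let $q_{ij}\in k^{*}$ ($1\le i,j\le n$) satisfy $q_{ii}=1$ and $q_{ji}=q_{ij}^{-1}$. Put $$S=k\langle x_1,\dots,x_n \mid x_ix_j=q_{ij}x_jx_i\ (i<j),\quad x_i^{N_i}=0\ (1\le i\le t)\rangle ,$$ let $k$ be the left $S$-module on which every $x_i$ acts as $0$, and let $H^*(S,k)=\bigoplus_{r\ge 0}\mathrm{Ext}_S^r(k,k)$ with the Yoneda product, where $\alpha\beta$ is the composite "first $\beta$, then $\alpha$". For $i\le t$ let $\sigma_i(a)=1$ if $a$ is odd and $\sigma_i(a)=N_i-1$ if $a$ is even; for $i>t$ let $\sigma_i(a)=1$; let $\tau_i(a)=\sum_{j=1}^{a}\sigma_i(j)$. Let $K_m$ be the free left $S$-module on generators $\Phi(a_1,\dots,a_n)$ with $a_i\ge 0$, $a_1+\dots+a_n=m$, and $a_i\in\{0,1\}$ for $i>t$. Then the maps $$d\,\Phi(a)=\sum_{i:\,a_i>0}\Big(\prod_{l>i}(-1)^{a_l}q_{li}^{\sigma_i(a_i)\tau_l(a_l)}\Big)x_i^{\sigma_i(a_i)}\,\Phi(a_1,\dots,a_i-1,\dots,a_n)$$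 together with the augmentation $\Phi(0,\dots,0)\mapsto 1$ make $K_\bullet$ a free resolution of $k$. Let $\xi_i\in H^2(S,k)$ ($1\le i\le t$) and $\eta_i\in H^1(S,k)$ ($1\le i\le n$) be the classes of the functions $K_2\to k$ and $K_1\to k$ dual to the generators $\Phi(0,\dots,2,\dots,0)$ and $\Phi(0,\dots,1,\dots,0)$, with the nonzero entry in position $i$. The $k$-algebra $H^*(S,k)$ is generated by the $\xi_i$ (degree $2$) and the $\eta_i$ (degree $1$), and they satisfy $$\xi_i\xi_j=q_{ji}^{N_iN_j}\xi_j\xi_i,\qquad \eta_i\xi_j=q_{ji}^{N_j}\xi_j\eta_i,\qquad \eta_i\eta_j=-q_{ji}\eta_j\eta_i\quad(i\ne j),$$ $\eta_i^2=0$ if $i>t$ or $N_i\ne 2$, and $\eta_i^2=c_i\xi_i$ with some $c_i\in k^{*}$ if $i\le t$ and $N_i=2$. These generators and relations are a presentation of the $k$-algebra $H^*(S,k)$. Moreover the monomials $$\xi_1^{b_1}\cdots\xi_t^{b_t}\,\eta_1^{c_1}\cdots\eta_n^{c_n},\qquad b_i\ge 0,\ c_i\in\{0,1\},$$ form a $k$-basis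 of $H^*(S,k)$. -/

import Mathlib

open CategoryTheory
open scoped DirectSum

universe u

noncomputable section

/-! ### The Yoneda algebra of an object of a linear abelian category -/

namespace ExtAlgebra

variable {C : Type*} [Category C] [Abelian C] [HasExt.{u} C]

/-- The graded components `Ext^r(X, X)`. -/
abbrev Comp (X : C) (r : ℕ) : Type u := Abelian.Ext.{u} X X r

/-- Multiplication is composition: `α * β` is "first `β`, then `α`" (Mathlib's `Ext.comp` is
written in diagrammatic order). -/
instance instGMul (X : C) : GradedMonoid.GMul (Comp X) where
  mul {a b} α β := Abelian.Ext.comp β α (add_comm b a)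

instance instGOne (X : C) : GradedMonoid.GOne (Comp X) where
  one := Abelian.Ext.mk₀ (𝟙 X)

theorem gmul_def {X : C} {a b : ℕ} (α : Comp X a) (β : Comp X b) :
    GradedMonoid.GMul.mul α β = Abelian.Ext.comp β α (add_comm b a) := rfl

theorem gone_def {X : C} :
    (GradedMonoid.GOne.one : Comp X 0) = Abelian.Ext.mk₀ (𝟙 X) := rfl

theorem comp_mk {X : C} {a b c c' : ℕ} (α : Comp X a) (β : Comp X b) (h : a + b = c)
    (h' : a + b = c') : (GradedMonoid.mk c (α.comp β h) : GradedMonoid (Comp X)) =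
      GradedMonoid.mk c' (α.comp β h') := by
  subst h; subst h'; rfl

instance instGSemiring (X : C) : DirectSum.GSemiring (Comp X) where
  mul_zero a := by simp [gmul_def]
  zero_mul a := by simp [gmul_def]
  mul_add a b c := by simp [gmul_def]
  add_mul a b c := by simp [gmul_def]
  one_mul := by
    rintro ⟨a, α⟩
    refine (comp_mk α (Abelian.Ext.mk₀ (𝟙 X)) _ (add_zero a)).trans ?_
    rw [Abelian.Ext.comp_mk₀_id]; rfl
  mul_one := by
    rintro ⟨a, α⟩
    refine (comp_mk (Abelian.Ext.mk₀ (𝟙 X)) α _ (zero_add a)).trans ?_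
    rw [Abelian.Ext.mk₀_id_comp]; rfl
  mul_assoc := by
    rintro ⟨a, α⟩ ⟨b, β⟩ ⟨c, γ⟩
    change (GradedMonoid.mk (a + b + c) (γ.comp (β.comp α (add_comm b a)) _) :
      GradedMonoid (Comp X)) =
      GradedMonoid.mk (a + (b + c)) ((γ.comp β (add_comm c b)).comp α _)
    rw [Abelian.Ext.comp_assoc γ β α (add_comm c b) (add_comm b a) (by omega)]
    exact comp_mk _ _ _ _
  natCast n := n • Abelian.Ext.mk₀ (𝟙 X)
  natCast_zero := zero_smul _ _
  natCast_succ n := by rw [add_smul, one_smul]; rfl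

variable (k : Type*) [Field k] [Linear k C]

instance instGAlgebra (X : C) : DirectSum.GAlgebra k (Comp X) where
  toFun := { toFun := fun r => r • (Abelian.Ext.mk₀ (𝟙 X) : Comp X 0)
             map_zero' := zero_smul _ _
             map_add' := fun r s => add_smul r s _ }
  map_one := one_smul _ _
  map_mul r s := by
    change _ = (GradedMonoid.mk (0 + 0) ((s • (Abelian.Ext.mk₀ (𝟙 X) : Comp X 0)).comp
      (r • (Abelian.Ext.mk₀ (𝟙 X) : Comp X 0)) _) : GradedMonoid (Comp X))
    rw [Abelian.Ext.comp_smul, Abelian.Ext.smul_comp, Abelian.Ext.comp_mk₀_id, smul_smul]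
    rfl
  commutes := by
    rintro r ⟨a, α⟩
    change (GradedMonoid.mk (0 + a) (α.comp (r • (Abelian.Ext.mk₀ (𝟙 X) : Comp X 0)) _) :
      GradedMonoid (Comp X)) =
      GradedMonoid.mk (a + 0) ((r • (Abelian.Ext.mk₀ (𝟙 X) : Comp X 0)).comp α _)
    refine (comp_mk _ _ _ (add_zero a)).trans (Eq.trans ?_ (comp_mk _ _ (zero_add a) _))
    rw [Abelian.Ext.comp_smul, Abelian.Ext.smul_comp, Abelian.Ext.comp_mk₀_id,
      Abelian.Ext.mk₀_id_comp]
  smul_def := by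
    rintro r ⟨a, α⟩
    change (GradedMonoid.mk a (r • α) : GradedMonoid (Comp X)) =
      GradedMonoid.mk (0 + a) (α.comp (r • (Abelian.Ext.mk₀ (𝟙 X) : Comp X 0)) _)
    refine Eq.trans ?_ (comp_mk _ _ (add_zero a) _)
    rw [Abelian.Ext.comp_smul, Abelian.Ext.comp_mk₀_id]

end ExtAlgebra

/-! ### Truncated quantum symmetric algebras -/

/-- The parameters: `n` generators, of which the first `t` are truncated at exponents `N i ≥ 2`,
and a multiplicatively antisymmetric matrix `q` of nonzero scalars. Indices start at `0`. -/
structure QuantumData (k : Type u) [Field k] where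
  n : ℕ
  t : ℕ
  t_le : t ≤ n
  N : Fin t → ℕ
  one_lt_N : ∀ i, 1 < N i
  q : Fin n → Fin n → k
  q_ne_zero : ∀ i j, q i j ≠ 0
  q_self : ∀ i, q i i = 1
  q_inv : ∀ i j, q j i = (q i j)⁻¹

namespace QuantumData

variable {k : Type u} [Field k] (D : QuantumData k)

/-- The inclusion of the truncated indices among all indices. -/
def inc (i : Fin D.t) : Fin D.n := Fin.castLE D.t_le i

/-- The defining relations of the truncated quantum symmetric algebra. -/
inductive Rel : FreeAlgebra k (Fin D.n) → FreeAlgebra k (Fin D.n) → Prop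
  | comm (i j : Fin D.n) (h : i < j) :
      Rel (FreeAlgebra.ι k i * FreeAlgebra.ι k j)
        (D.q i j • (FreeAlgebra.ι k j * FreeAlgebra.ι k i))
  | pow (i : Fin D.t) : Rel (FreeAlgebra.ι k (D.inc i) ^ D.N i) 0

/-- The algebra `S = k⟨x₁, …, xₙ | xᵢxⱼ = qᵢⱼ xⱼxᵢ (i < j), xᵢ^Nᵢ = 0 (i ≤ t)⟩`. -/
abbrev S : Type u := RingQuot D.Rel

/-- The generator `xᵢ` of `S`. -/
def x (i : Fin D.n) : D.S := RingQuot.mkAlgHom k D.Rel (FreeAlgebra.ι k i)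

/-- The augmentation `S → k`, sending every `xᵢ` to `0`. -/
def aug : D.S →ₐ[k] k :=
  RingQuot.liftAlgHom k ⟨FreeAlgebra.lift k (fun _ => (0 : k)), by
    intro a b h
    cases h with
    | comm i j h => simp
    | pow i =>
      have h0 : D.N i ≠ 0 := by have := D.one_lt_N i; omega
      simp [h0]⟩

theorem aug_x (i : Fin D.n) : D.aug (D.x i) = 0 := by
  simp [aug, x]

/-- The trivial left `S`-module `k`, on which every `xᵢ` acts as zero. -/
def trivialModule : ModuleCat.{u} D.S :=
  @ModuleCat.of D.S _ k _ (Module.compHom k D.aug.toRingHom)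

/-- The underlying space of the trivial module is `k`. -/
def toField (m : D.trivialModule) : k := m

/-- The cohomology algebra `H^*(S, k) = ⨁ᵣ Ext^r_S(k, k)`, with the Yoneda product. -/
abbrev Cohomology : Type u := ⨁ r, ExtAlgebra.Comp D.trivialModule r

/-- The class in `H^*(S, k)` of an element of `Ext^r_S(k, k)`. -/
def homog (r : ℕ) (α : ExtAlgebra.Comp D.trivialModule r) : D.Cohomology :=
  DirectSum.of (ExtAlgebra.Comp D.trivialModule) r α

/-! ### The twisted tensor product resolution -/

/-- `σᵢ(a)` is `1` if `a` is odd or `i > t`, and `Nᵢ - 1` if `a` is even and `i ≤ t`. -/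
def sigma (i : Fin D.n) (a : ℕ) : ℕ :=
  if h : (i : ℕ) < D.t then (if Odd a then 1 else D.N ⟨i, h⟩ - 1) else 1

/-- `τᵢ(a) = σᵢ(1) + ⋯ + σᵢ(a)`. -/
def tau (i : Fin D.n) (a : ℕ) : ℕ := ∑ j ∈ Finset.Icc 1 a, D.sigma i j

/-- The tuples `(a₁, …, aₙ)` with `a₁ + ⋯ + aₙ = m` and `aᵢ ∈ {0, 1}` for `i > t`. -/
def Index (m : ℕ) : Type :=
  {a : Fin D.n → ℕ // (∀ i : Fin D.n, D.t ≤ (i : ℕ) → a i ≤ 1) ∧ ∑ i, a i = m}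

variable {D} in
/-- Lower the `i`-th entry of a tuple by one. -/
def Index.lower {m : ℕ} (a : D.Index (m + 1)) (i : Fin D.n) (h : 0 < a.1 i) : D.Index m :=
  ⟨Function.update a.1 i (a.1 i - 1), by
    constructor
    · intro j hj
      have := a.2.1 j hj
      by_cases hji : j = i
      · subst hji; simp; omega
      · simpa [hji] using this
    · have h1 := a.2.2
      have h2 := Finset.sum_update_of_mem (Finset.mem_univ i) a.1 (a.1 i - 1)
      have h3 := Finset.add_sum_erase Finset.univ a.1 (Finset.mem_univ i)
      rw [Finset.sdiff_singleton_eq_erase] at h2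
      omega⟩

/-- The scalar `∏_{l > i} (-1)^{a_l} q_{li}^{σᵢ(aᵢ) τ_l(a_l)}`. -/
def dCoeff (a : Fin D.n → ℕ) (i : Fin D.n) : k :=
  ∏ l ∈ Finset.univ.filter (fun l => i < l),
    ((-1) ^ a l * D.q l i ^ (D.sigma i (a i) * D.tau l (a l)))

/-- The resolution `K_•` of `k`: `K_m` is free over `S` on generators `Φ(a₁, …, aₙ)` with
`a₁ + ⋯ + aₙ = m`, the augmentation sends `Φ(0, …, 0)` to `1`, and
`d Φ(a) = ∑ᵢ (∏_{l > i} (-1)^{a_l} q_{li}^{σᵢ(aᵢ) τ_l(a_l)}) xᵢ^{σᵢ(aᵢ)} Φ(a - eᵢ)`. -/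
structure TwistedResolution where
  res : ProjectiveResolution D.trivialModule
  Φ : ∀ m, Module.Basis (D.Index m) D.S (res.complex.X m)
  d_Φ : ∀ (m : ℕ) (a : D.Index (m + 1)),
    (res.complex.d (m + 1) m).hom (Φ (m + 1) a) =
      ∑ i, if h : 0 < a.1 i then
        (D.dCoeff a.1 i • D.x i ^ D.sigma i (a.1 i)) • Φ m (a.lower i h) else 0
  aug_Φ : ∀ a : D.Index 0,
    D.toField ((res.π.f 0 ≫ (HomologicalComplex.singleObjXSelf _ 0 D.trivialModule).hom).hom (Φ 0 a)) = 1

variable {D} in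
/-- `α` is the class in `Ext^m_S(k, k)` of the `S`-linear function `K_m → k` dual to the
generator `Φ(a)`, i.e. sending `Φ(a)` to `1` and every other generator to `0`. -/
def TwistedResolution.IsDualClass (K : D.TwistedResolution) {m : ℕ} (a : Fin D.n → ℕ)
    (α : ExtAlgebra.Comp D.trivialModule m) : Prop :=
  ∃ (f : K.res.complex.X m ⟶ D.trivialModule) (hf : K.res.complex.d (m + 1) m ≫ f = 0),
    (∀ b : D.Index m, D.toField (f.hom (K.Φ m b)) = if b.1 = a then 1 else 0) ∧
      α = K.res.extMk f (m + 1) rfl hf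

/-! ### The presentation of the cohomology algebra -/

/-- The relations among free generators `ξ_j = inl j` and `η_i = inr i`. -/
inductive CohRel (c : Fin D.t → k) :
    FreeAlgebra k (Fin D.t ⊕ Fin D.n) → FreeAlgebra k (Fin D.t ⊕ Fin D.n) → Prop
  | xi_xi (i j : Fin D.t) :
      CohRel c (FreeAlgebra.ι k (Sum.inl i) * FreeAlgebra.ι k (Sum.inl j))
        (D.q (D.inc j) (D.inc i) ^ (D.N i * D.N j) •
          (FreeAlgebra.ι k (Sum.inl j) * FreeAlgebra.ι k (Sum.inl i)))
  | eta_xi (i : Fin D.n) (j : Fin D.t) :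
      CohRel c (FreeAlgebra.ι k (Sum.inr i) * FreeAlgebra.ι k (Sum.inl j))
        (D.q (D.inc j) i ^ D.N j •
          (FreeAlgebra.ι k (Sum.inl j) * FreeAlgebra.ι k (Sum.inr i)))
  | eta_eta (i j : Fin D.n) (h : i ≠ j) :
      CohRel c (FreeAlgebra.ι k (Sum.inr i) * FreeAlgebra.ι k (Sum.inr j))
        (-D.q j i • (FreeAlgebra.ι k (Sum.inr j) * FreeAlgebra.ι k (Sum.inr i)))
  | eta_sq_zero (i : Fin D.n) (h : ∀ j : Fin D.t, D.inc j = i → D.N j ≠ 2) :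
      CohRel c (FreeAlgebra.ι k (Sum.inr i) ^ 2) 0
  | eta_sq (j : Fin D.t) (h : D.N j = 2) :
      CohRel c (FreeAlgebra.ι k (Sum.inr (D.inc j)) ^ 2) (c j • FreeAlgebra.ι k (Sum.inl j))

variable {D} in
/-- The ordered monomial `ξ₁^{b₁} ⋯ ξ_t^{b_t} η₁^{c₁} ⋯ ηₙ^{cₙ}`. -/
def monomial (ξ : Fin D.t → D.Cohomology) (η : Fin D.n → D.Cohomology)
    (b : Fin D.t → ℕ) (c : Fin D.n → Fin 2) : D.Cohomology :=
  (List.ofFn fun j => ξ j ^ b j).prod * (List.ofFn fun i => η i ^ (c i : ℕ)).prod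

end QuantumData

end

noncomputable section

/-! ### Composition of extension classes computed on a projective resolution -/

namespace CochainComplex.HomComplex.Cocycle

variable {C : Type*} [Category* C] [Preadditive C] {K L M : CochainComplex C ℤ}

/-! The complex `K` is a twisted tensor product of the periodic resolutions of k over
k[x_i]/(x_i^{N_i}) for i ≤ t and the Koszul resolutions over k[x_i] for i > t. Its exactness comes
from an explicit k-linear contraction `homotopy`. On X^u Φ(a), take the largest i at which u or a is
nonzero and trade a factor x_i^{σ_i(a_i+1)} for raising a_i by one. Nothing lies to the right of i,
so no scalar is needed. In direction i the one-variable identity holds because σ_i(a) + σ_i(a+1) =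
N_i (`top_alternative`). In directions j < i the terms of dh and hd cancel by comparing powers of
q_ij (`dCoeff_add_single`). Working on the X^u requires that the admissible monomials form a basis
of S (`basisX`). Even d² = 0 is a consequence of the contraction (`diff_diff`).

The coefficients of d lie in the augmentation ideal, so Ext^m has the basis dual to the generators
Φ(a) (`extLinear_bijective`). A Yoneda product αβ is computed by lifting β to a chain map and
composing with α (`extMk_comp_extMk`). The lifts of ξ_i and η_i are monomial: they lower a_i by 2 or
1, with a scalar and, for η_i, a factor x_i^{σ_i(a_i)-1} (`diff_xiLift`, `diff_etaLift`). Hence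
right multiplication by ξ_i or η_i takes the class dual to Φ(a) to a multiple of the class dual to
Φ(a+2e_i) or Φ(a+e_i) (`cls_gmul_xi`, `cls_gmul_eta`). This multiple is nonzero for ξ_i, and
vanishes for η_i exactly when σ_i(a_i+1) ≠ 1.

The relations follow by comparing these scalars. Every index is uniquely a = 2b + c with c_i ∈
{0,1}, so the ordered monomials are nonzero multiples of the dual classes and form a basis. In the
algebra presented by the relations the ordered monomials span, and they map to this basis, so the
presentation is faithful. -/

lemma equivHomShift_shiftedHom_comp {a b c : ℤ} (f : K ⟶ L⟦a⟧) (g : L ⟶ M⟦b⟧) (h : b + a = c) :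
    (equivHomShift (ShiftedHom.comp f g h)).1 =
      (equivHomShift f).1.comp (equivHomShift g).1 (by lia) := by
  ext p q hpq
  rw [Cochain.comp_v _ _ _ p (p + a) q rfl (by lia)]
  simp [equivHomShift_apply, Cochain.rightUnshift_v _ _ _ _ _ _ _ (add_zero _), ShiftedHom.comp,
    shiftFunctorAdd'_inv_app_f', HomologicalComplex.XIsoOfEq]
  -- The objects are generalized so that the equalities between them can be substituted away.
  have key {X₁ X₂ X₃ X₄ X₅ : C} (u : X₁ ⟶ X₂) (v : X₂ ⟶ X₃) (e₁ : X₃ = X₄) (e₂ : X₄ = X₅) :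
      (u ≫ v ≫ eqToHom e₁) ≫ eqToHom e₂ = (u ≫ 𝟙 X₂) ≫ v ≫ eqToHom (e₁.trans e₂) := by
    subst e₁ e₂
    simp
  exact key _ _ _ _

end CochainComplex.HomComplex.Cocycle

namespace CategoryTheory.ProjectiveResolution

open CochainComplex HomComplex Abelian

variable {C : Type*} [Category* C] [Abelian C] {X Y : C}
  (R : ProjectiveResolution X)

/-- A family of morphisms `X_p ⟶ X_m` (`m + n = p`) on a projective resolution, as a cochain. -/
def liftCochain (n : ℕ) (φ : ∀ m p, m + n = p → (R.complex.X p ⟶ R.complex.X m)) :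
    Cochain R.cochainComplex R.cochainComplex n :=
  Cochain.mk fun p q hpq =>
    -- Homological degree m sits in cohomological degree -m; the complex vanishes in positive
    -- degrees, hence the value 0 there.
    if h : q ≤ 0 then
      (R.cochainComplexXIso p ((-p).toNat) (by lia)).hom ≫ φ ((-q).toNat) ((-p).toNat) (by lia) ≫
        (R.cochainComplexXIso q ((-q).toNat) (by lia)).inv
    else 0

lemma liftCochain_v {n : ℕ} (φ : ∀ m p, m + n = p → (R.complex.X p ⟶ R.complex.X m))
    (p q : ℤ) (hpq : p + n = q) (a b : ℕ) (ha : -(a : ℤ) = p) (hb : -(b : ℤ) = q) :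
    (R.liftCochain n φ).v p q hpq =
      (R.cochainComplexXIso p a ha).hom ≫ φ b a (by lia) ≫ (R.cochainComplexXIso q b hb).inv := by
  obtain rfl : a = (-p).toNat := by lia
  obtain rfl : b = (-q).toNat := by lia
  simp only [liftCochain, Cochain.mk_v]
  rw [dif_pos (by lia)]

/-- Commutation with d up to (-1)^n is precisely the cocycle condition in the Hom complex; in
positive target degrees the complex is zero and there is nothing to check. -/
lemma δ_liftCochain {n : ℕ} (φ : ∀ m p, m + n = p → (R.complex.X p ⟶ R.complex.X m))
    (hφ : ∀ m p (h : m + n = p), φ (m + 1) (p + 1) (by lia) ≫ R.complex.d (m + 1) m =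
      (-1 : ℤ) ^ n • (R.complex.d (p + 1) p ≫ φ m p h)) :
    δ (n : ℤ) (n + 1) (R.liftCochain n φ) = 0 := by
  ext p q hpq
  rw [δ_v _ _ rfl _ p q hpq (q - 1) (p + 1) (by lia) (by lia)]
  by_cases hq : q ≤ 0
  · obtain ⟨b, rfl⟩ := Int.exists_eq_neg_ofNat hq
    rw [R.liftCochain_v φ p _ _ (b + 1 + n) (b + 1) (by push_cast; lia) (by lia),
      R.liftCochain_v φ (p + 1) _ _ (b + n) b (by push_cast; lia) (by lia),
      R.cochainComplex_d _ _ (b + 1) b (by push_cast; lia) (by lia),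
      R.cochainComplex_d _ _ (b + 1 + n) (b + n) (by push_cast; lia) (by push_cast; lia)]
    have e : b + 1 + n = b + n + 1 := by lia
    have := hφ b (b + n) rfl
    simp only [Category.assoc, Iso.inv_hom_id_assoc, Cochain.zero_v]
    have h2 : φ (b + 1) (b + 1 + n) rfl ≫ R.complex.d (b + 1) b =
      (-1 : ℤ) ^ n • (R.complex.d (b + 1 + n) (b + n) ≫ φ b (b + n) rfl) := by
      have key : ∀ r (hr : r = b + n + 1), φ (b + 1) r (by lia) ≫ R.complex.d (b + 1) b =
        (-1 : ℤ) ^ n • (R.complex.d r (b + n) ≫ φ b (b + n) rfl) := by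
        rintro r rfl; exact this
      exact key _ e
    rw [reassoc_of% h2]
    rcases Nat.even_or_odd n with hn | hn
    · have : Int.negOnePow ((n : ℤ) + 1) = -1 := by
        rw [Int.negOnePow_odd]; exact_mod_cast hn.add_one
      simp [this, hn.neg_one_pow]
    · have : Int.negOnePow ((n : ℤ) + 1) = 1 := by
        rw [Int.negOnePow_even]; exact_mod_cast hn.add_one
      simp [this, hn.neg_one_pow]
  · exact (CochainComplex.isZero_of_isStrictlyLE R.cochainComplex 0 q (by lia)).eq_of_tgt _ _

variable [HasExt.{u} C]

/-- The composition of extension classes, computed by lifting the first cocycle to a chain map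
of degree `-n`. -/
theorem extMk_comp_extMk {n m r : ℕ} (f : R.complex.X n ⟶ X) (n' : ℕ) (hn' : n + 1 = n')
    (hf : R.complex.d n' n ≫ f = 0)
    (φ : ∀ m p, m + n = p → (R.complex.X p ⟶ R.complex.X m))
    (hφ : ∀ m p (h : m + n = p), φ (m + 1) (p + 1) (by lia) ≫ R.complex.d (m + 1) m =
      (-1 : ℤ) ^ n • (R.complex.d (p + 1) p ≫ φ m p h))
    (hφ₀ : φ 0 n (by lia) ≫ R.π.f 0 ≫ (HomologicalComplex.singleObjXSelf _ 0 X).hom = f)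
    (g : R.complex.X m ⟶ Y) (m' : ℕ) (hm' : m + 1 = m') (hg : R.complex.d m' m ≫ g = 0)
    (h : n + m = r) (r' : ℕ) (hr' : r + 1 = r') (hfg : R.complex.d r' r ≫ φ m r (by lia) ≫ g = 0) :
    (R.extMk f n' hn' hf).comp (R.extMk g m' hm' hg) h =
      R.extMk (φ m r (by lia) ≫ g) r' hr' hfg := by
  have := HasDerivedCategory.standard C
  let z : Cocycle R.cochainComplex R.cochainComplex n :=
    Cocycle.mk (R.liftCochain n φ) (n + 1) rfl (R.δ_liftCochain φ hφ)
  ext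
  rw [Ext.comp_hom, extMk_hom, extMk_hom, extMk_hom]
  -- The cocycle of f is `z` followed by the augmentation. Both land in a complex concentrated in
  -- degree 0, so it suffices to compare a single component, where `hφ₀` applies.
  have h1 : Cocycle.toSingleMk (q := 0) (n := n) ((R.cochainComplexXIso (-n) n rfl).hom ≫ f) (by simp) (-n')
      (by lia) (by simpa [cochainComplex_d _ _ _ _ _ rfl rfl]) = z.postcomp R.π' := by
    ext : 1
    apply (Cochain.toSingleEquiv (show -(n : ℤ) + n = 0 by simp)).injective
    subst hφ₀
    simp [Cochain.toSingleEquiv, z, R.π'_f_zero,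
      R.liftCochain_v φ (-n : ℤ) 0 (by simp) n 0 (by simp) (by simp)]
    have key {X₁ X₂ X₃ X₄ X₅ X₆ X₇ : C} (a : X₁ ⟶ X₂) (b : X₂ ⟶ X₃) (e : X₄ ≅ X₃) (p : X₃ ⟶ X₇)
        (u : X₇ ⟶ X₅) (v : X₅ ⟶ X₆) :
        (a ≫ b ≫ (p ≫ 𝟙 X₇) ≫ u) ≫ v = ((a ≫ b ≫ e.inv) ≫ e.hom ≫ p ≫ u) ≫ v := by simp
    exact key _ _ _ _ _ _
  -- Likewise the cocycle of φ ≫ g is `z` followed by that of g.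
  have h2 : Cocycle.toSingleMk (q := 0) (n := r) ((R.cochainComplexXIso (-r) r rfl).hom ≫ φ m r (by lia) ≫ g)
      (by simp) (-r') (by lia) (by simpa [cochainComplex_d _ _ _ _ _ rfl rfl]) =
      Cocycle.equivHomShift (ShiftedHom.comp (Cocycle.equivHomShift.symm z)
        (Cocycle.equivHomShift.symm (Cocycle.toSingleMk (q := 0) (n := m)
          ((R.cochainComplexXIso (-m) m rfl).hom ≫ g) (by simp) (-m')
          (by lia) (by simpa [cochainComplex_d _ _ _ _ _ rfl rfl]))) (by lia)) := by
    ext : 1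
    apply (Cochain.toSingleEquiv (show -(r : ℤ) + r = 0 by simp)).injective
    rw [Cocycle.equivHomShift_shiftedHom_comp]
    simp only [Cochain.toSingleEquiv, AddEquiv.coe_mk, Equiv.coe_fn_mk]
    rw [Cochain.comp_v _ _ _ (-r : ℤ) (-m : ℤ) 0 (by lia) (by simp)]
    simp [z, R.liftCochain_v φ (-r : ℤ) (-m) (by lia) r m (by simp) (by simp)]
    have key {X₁ X₂ X₃ X₄ X₅ X₆ : C} (a : X₁ ⟶ X₂) (b : X₂ ⟶ X₃) (e : X₄ ≅ X₃) (u : X₃ ⟶ X₅)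
        (v : X₅ ⟶ X₆) : (a ≫ b ≫ u) ≫ v = ((a ≫ b ≫ e.inv) ≫ e.hom ≫ u) ≫ v := by simp
    exact key _ _ _ _ _
  rw [h1, h2, Cocycle.equivHomShift_symm_postcomp, AddEquiv.symm_apply_apply,
    ← ShiftedHom.comp_mk₀ _ 0 rfl]
  rw [ShiftedHom.map_comp, ShiftedHom.map_comp, ShiftedHom.map_mk₀]
  -- An extension class is the inverse of the quasi-isomorphism `π'` followed by its cocycle; in the
  -- composite, `π'` at the end of the first factor meets its inverse at the start of the second and
  -- cancels.
  have e {Z : DerivedCategory C} (t : DerivedCategory.Q.obj R.cochainComplex ⟶ Z) :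
      DerivedCategory.Q.map R.π' ≫ (DerivedCategory.singleFunctorIsoCompQ C 0).inv.app X ≫
      (DerivedCategory.singleFunctorIsoCompQ C 0).hom.app X ≫
        inv (DerivedCategory.Q.map R.π') ≫ t = t := by simp
  simp only [ShiftedHom.mk₀_comp, ShiftedHom.comp_mk₀]
  simp only [ShiftedHom.comp, Category.assoc, Functor.map_comp]
  simp only [← Functor.map_comp_assoc]
  rw [e]
  simp only [Functor.map_comp, Category.assoc]
  congr 4
  exact (shiftFunctorAdd' (DerivedCategory C) (m : ℤ) n r (by lia)).inv.naturality
    ((DerivedCategory.singleFunctorIsoCompQ C 0).inv.app Y)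

/-- The identity chain map lifts the augmentation, so the class of the augmentation is a unit for
composition; composing it with a representative of the identity class gives the claim. -/
lemma extMk_π : R.extMk (R.π.f 0 ≫ (HomologicalComplex.singleObjXSelf _ 0 X).hom) 1 rfl
    (by rw [← R.π.comm_assoc]; simp) = Ext.mk₀ (𝟙 X) := by
  obtain ⟨g, hg, h⟩ := R.extMk_surjective (Ext.mk₀ (𝟙 X)) 1 rfl
  have key := R.extMk_comp_extMk (R.π.f 0 ≫ (HomologicalComplex.singleObjXSelf _ 0 X).hom) 1 rfl
    (by rw [← R.π.comm_assoc]; simp) (fun m p h => eqToHom (by rw [← h]; rfl))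
    (by rintro m p rfl; simp) (by simp) g 1 rfl hg (zero_add 0) 1 rfl (by simp [hg])
  simp only [eqToHom_refl, Category.id_comp] at key
  rwa [h, Ext.comp_mk₀_id] at key

end CategoryTheory.ProjectiveResolution

/-! ### Ordered monomials in quasi-commuting elements -/

section OrderedMonomials

variable {k A : Type*} [Field k] [Ring A] [Algebra k A]

/-- The ordered monomial `z₁^{u₁} ⋯ zₙ^{uₙ}`. -/
def orderedMonomial {n : ℕ} (z : Fin n → A) (u : Fin n → ℕ) : A :=
  (List.ofFn fun i => z i ^ u i).prod

lemma orderedMonomial_zero {n : ℕ} (z : Fin n → A) : orderedMonomial z 0 = 1 := by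
  simp [orderedMonomial]

lemma orderedMonomial_succ {n : ℕ} (z : Fin (n + 1) → A) (u : Fin (n + 1) → ℕ) :
    orderedMonomial z u =
      z 0 ^ u 0 * orderedMonomial (fun i => z i.succ) (fun i => u i.succ) := by
  simp [orderedMonomial, List.ofFn_succ]

lemma orderedMonomial_eq_zero {n : ℕ} [Nontrivial A] (z : Fin n → A) (u : Fin n → ℕ) (i : Fin n)
    (h : z i ^ u i = 0) : orderedMonomial z u = 0 :=
  List.prod_eq_zero (by rw [List.mem_ofFn]; exact ⟨i, h⟩)

lemma pow_mul_eq_smul {y w : A} {c : k} (h : y * w = c • (w * y)) (m : ℕ) :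
    y ^ m * w = c ^ m • (w * y ^ m) := by
  induction m with
  | zero => simp
  | succ m ih =>
    rw [pow_succ, mul_assoc, h, mul_smul_comm, ← mul_assoc, ih, smul_mul_assoc, smul_smul,
      mul_assoc, pow_succ' c]

lemma mul_pow_eq_smul {y w : A} {c : k} (h : y * w = c • (w * y)) (m : ℕ) :
    y * w ^ m = c ^ m • (w ^ m * y) := by
  induction m with
  | zero => simp
  | succ m ih =>
    rw [pow_succ, ← mul_assoc, ih, smul_mul_assoc, mul_assoc, h, mul_smul_comm, smul_smul,
      ← mul_assoc, pow_succ c]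

lemma pow_mul_pow_eq_smul {y w : A} {c : k} (h : y * w = c • (w * y)) (m p : ℕ) :
    y ^ m * w ^ p = c ^ (m * p) • (w ^ p * y ^ m) := by
  rw [pow_mul]
  exact mul_pow_eq_smul (pow_mul_eq_smul h m) p

lemma orderedMonomial_mul {n : ℕ} (z : Fin n → A) (w : A) (c : Fin n → k)
    (h : ∀ l, z l * w = c l • (w * z l)) (u : Fin n → ℕ) :
    orderedMonomial z u * w = (∏ l, c l ^ u l) • (w * orderedMonomial z u) := by
  induction n with
  | zero => simp [orderedMonomial]
  | succ n ih =>
    rw [orderedMonomial_succ, mul_assoc, ih _ (fun i => c i.succ) (fun i => h _),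
      mul_smul_comm, ← mul_assoc, pow_mul_eq_smul (h 0), smul_mul_assoc, smul_smul,
      Fin.prod_univ_succ, mul_comm, mul_assoc]

/-- The new factor crosses only the factors to the right of its place, so only indices l > j
contribute and only those commutation rules are needed. -/
lemma orderedMonomial_mul_self {n : ℕ} (z : Fin n → A) (q : Fin n → Fin n → k)
    (h : ∀ j l, j < l → z l * z j = q l j • (z j * z l)) (u : Fin n → ℕ) (j : Fin n) :
    orderedMonomial z u * z j =
      (∏ l ∈ Finset.univ.filter (fun l => j < l), q l j ^ u l) •
        orderedMonomial z (u + Pi.single j 1) := by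
  induction n with
  | zero => exact j.elim0
  | succ n ih =>
    rw [Finset.prod_filter, Fin.prod_univ_succ]
    rw [orderedMonomial_succ, mul_assoc]
    induction j using Fin.cases with
    | zero =>
      rw [orderedMonomial_mul _ _ (fun l => q l.succ 0) (fun l => h _ _ (Fin.succ_pos l)),
        orderedMonomial_succ, mul_smul_comm, ← mul_assoc, ← pow_succ]
      simp
    | succ j =>
      rw [ih _ (fun a b => q a.succ b.succ) (fun a b hab => h _ _ (Fin.succ_lt_succ_iff.mpr hab)),
        orderedMonomial_succ, Finset.prod_filter, mul_smul_comm]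
      congr 1
      · simp
      · congr 1
        · simp [Pi.single_apply]
          congr 1
          ext i
          simp [Pi.single_apply]

/-- A subspace which contains `1` and is stable under right multiplication by generators is the
whole algebra. -/
lemma Submodule.eq_top_of_mul_mem {s : Set A} (hs : Algebra.adjoin k s = ⊤) (W : Submodule k A)
    (h1 : 1 ∈ W) (hW : ∀ g ∈ s, ∀ w ∈ W, w * g ∈ W) : W = ⊤ := by
  have key : ∀ y ∈ Algebra.adjoin k s, ∀ w ∈ W, w * y ∈ W := by
    intro y hy
    induction hy using Algebra.adjoin_induction with
    | mem g hg => exact hW g hg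
    | algebraMap r => 
      intro w hw
      rw [← Algebra.commutes, ← Algebra.smul_def]
      exact W.smul_mem r hw
    | add a b _ _ ha hb =>
      intro w hw
      rw [mul_add]
      exact W.add_mem (ha w hw) (hb w hw)
    | mul a b _ _ ha hb =>
      intro w hw
      rw [← mul_assoc]
      exact hb _ (ha w hw)
  rw [eq_top_iff]
  intro y _
  simpa using key y (by rw [hs]; trivial) 1 h1

lemma RingQuot.adjoin_range_mkAlgHom_ι {ι : Type*} (r : FreeAlgebra k ι → FreeAlgebra k ι → Prop) :
    Algebra.adjoin k (Set.range fun i => RingQuot.mkAlgHom k r (FreeAlgebra.ι k i)) = ⊤ := by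
  rw [Set.range_comp' (RingQuot.mkAlgHom k r) (FreeAlgebra.ι k), ← AlgHom.map_adjoin,
    FreeAlgebra.adjoin_range_ι, Algebra.map_top, AlgHom.range_eq_top]
  exact RingQuot.mkAlgHom_surjective k r

lemma sub_single_add_single {ι : Type*} [DecidableEq ι] {u : ι → ℕ} {j : ι} {m : ℕ}
    (h : m ≤ u j) : u - Pi.single j m + Pi.single j m = u := by
  funext i
  by_cases hi : i = j
  · subst hi
    simp [Nat.sub_add_cancel h]
  · simp [hi]

end OrderedMonomials

/-! ### The monomial basis of the truncated quantum symmetric algebra -/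

namespace QuantumData

variable {k : Type u} [Field k] (D : QuantumData k)

lemma q_mul_q (i j : Fin D.n) : D.q i j * D.q j i = 1 := by
  rw [D.q_inv i j, mul_inv_cancel₀ (D.q_ne_zero i j)]

lemma x_mul_x (i j : Fin D.n) : D.x i * D.x j = D.q i j • (D.x j * D.x i) := by
  have key : ∀ i j, i < j → D.x i * D.x j = D.q i j • (D.x j * D.x i) := by
    intro i j h
    have := RingQuot.mkAlgHom_rel k (Rel.comm (D := D) i j h)
    simpa [x] using this
  rcases lt_trichotomy i j with h | rfl | h
  · exact key i j h
  · simp [D.q_self]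
  · rw [key j i h, smul_smul, D.q_mul_q, one_smul]

lemma x_pow_mul_x_pow (i j : Fin D.n) (a b : ℕ) :
    D.x i ^ a * D.x j ^ b = D.q i j ^ (a * b) • (D.x j ^ b * D.x i ^ a) :=
  pow_mul_pow_eq_smul (D.x_mul_x i j) a b

lemma x_pow_N (i : Fin D.t) : D.x (D.inc i) ^ D.N i = 0 := by
  have := RingQuot.mkAlgHom_rel k (Rel.pow (D := D) i)
  simpa [x] using this

instance : Nontrivial D.S := D.aug.toRingHom.domain_nontrivial

/-- The ordered monomial `x₁^{u₁} ⋯ xₙ^{uₙ}` in `S`. -/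
def X (u : Fin D.n → ℕ) : D.S := orderedMonomial D.x u

lemma X_zero : D.X 0 = 1 := orderedMonomial_zero _

/-- The exponents of the nonzero monomials. -/
def Admissible (u : Fin D.n → ℕ) : Prop := ∀ i : Fin D.t, u (D.inc i) < D.N i

lemma X_eq_zero {u : Fin D.n → ℕ} (h : ¬ D.Admissible u) : D.X u = 0 := by
  simp only [Admissible, not_forall, not_lt] at h
  obtain ⟨i, hi⟩ := h
  apply orderedMonomial_eq_zero _ _ (D.inc i)
  rw [← Nat.sub_add_cancel hi, pow_add, D.x_pow_N, mul_zero]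

/-- The scalar which appears when `xⱼ` is moved to its place in a monomial. -/
def qX (u : Fin D.n → ℕ) (j : Fin D.n) : k :=
  ∏ l ∈ Finset.univ.filter (fun l => j < l), D.q l j ^ u l

lemma qX_ne_zero (u : Fin D.n → ℕ) (j : Fin D.n) : D.qX u j ≠ 0 :=
  Finset.prod_ne_zero_iff.mpr fun l _ => pow_ne_zero _ (D.q_ne_zero l j)

lemma qX_add (u v : Fin D.n → ℕ) (j : Fin D.n) : D.qX (u + v) j = D.qX u j * D.qX v j := by
  simp [qX, pow_add, Finset.prod_mul_distrib]

lemma qX_single (i j : Fin D.n) (m : ℕ) :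
    D.qX (Pi.single i m) j = if j < i then D.q i j ^ m else 1 := by
  rw [qX, Finset.prod_filter, Finset.prod_eq_single i]
  · simp
  · intro b _ hb
    simp [hb]
  · simp

lemma X_mul_x (u : Fin D.n → ℕ) (j : Fin D.n) :
    D.X u * D.x j = D.qX u j • D.X (u + Pi.single j 1) :=
  orderedMonomial_mul_self D.x D.q (fun j l _ => D.x_mul_x l j) u j

lemma X_mul_x_pow (u : Fin D.n → ℕ) (j : Fin D.n) (m : ℕ) :
    D.X u * D.x j ^ m = D.qX u j ^ m • D.X (u + Pi.single j m) := by
  induction m with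
  | zero => simp
  | succ m ih =>
    rw [pow_succ, ← mul_assoc, ih, smul_mul_assoc, X_mul_x, smul_smul, qX_add, qX_single,
      if_neg (lt_irrefl j), mul_one, ← pow_succ, add_assoc, ← Pi.single_add]

lemma Admissible.of_add {u v : Fin D.n → ℕ} (h : D.Admissible (u + v)) : D.Admissible u :=
  fun i => lt_of_le_of_lt (by simp) (h i)

open Classical in
/-- The operator on formal monomials which models right multiplication by `xⱼ`. -/
def rightMul (j : Fin D.n) : Module.End k ((Fin D.n → ℕ) →₀ k) :=
  Finsupp.linearCombination k fun u =>
    if D.Admissible (u + Pi.single j 1) then Finsupp.single (u + Pi.single j 1) (D.qX u j) else 0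

open Classical in
lemma rightMul_single (j : Fin D.n) (u : Fin D.n → ℕ) (c : k) :
    D.rightMul j (Finsupp.single u c) =
      if D.Admissible (u + Pi.single j 1) then
        Finsupp.single (u + Pi.single j 1) (c * D.qX u j) else 0 := by
  rw [rightMul, Finsupp.linearCombination_single]
  split_ifs <;> simp

/-- Composition reverses right multiplications, so this is the relation x_i x_j = q_ij x_j x_i. Both
sides vanish together when the final exponent is inadmissible; otherwise the scalars agree by q_ij
q_ji = 1. -/
lemma rightMul_comm (i j : Fin D.n) (h : i < j) :
    D.rightMul j * D.rightMul i = D.q i j • (D.rightMul i * D.rightMul j) := by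
  classical
  ext1 u
  ext1
  simp only [LinearMap.comp_apply, Finsupp.lsingle_apply, Module.End.mul_apply,
    LinearMap.smul_apply, rightMul_single]
  have e : u + Pi.single j 1 + Pi.single i 1 = u + Pi.single i 1 + Pi.single j 1 := by
    rw [add_right_comm]
  by_cases ha : D.Admissible (u + Pi.single i 1 + Pi.single j 1)
  · have hb := ha
    rw [← e] at hb
    rw [if_pos (Admissible.of_add D ha), if_pos (Admissible.of_add D hb), rightMul_single,
      rightMul_single, if_pos ha, if_pos hb, e, Finsupp.smul_single, qX_add, qX_add, qX_single,
      qX_single, if_pos h, if_neg h.le.not_gt]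
    congr 1
    have := D.q_mul_q i j
    simp only [smul_eq_mul, one_mul, pow_one, mul_one]
    linear_combination (-(D.qX u j * D.qX u i)) * this
  · have hb := ha
    rw [← e] at hb
    split_ifs <;> simp [rightMul_single, ha, hb]

lemma rightMul_pow (i : Fin D.t) : D.rightMul (D.inc i) ^ D.N i = 0 := by
  classical
  -- Only the exponent reached matters for nilpotency, so the scalar is left unspecified.
  have key : ∀ m u, ∃ c : k, (D.rightMul (D.inc i) ^ m) (Finsupp.single u 1) =
      Finsupp.single (u + Pi.single (D.inc i) m) c := by
    intro m u
    induction m with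
    | zero => exact ⟨1, by simp⟩
    | succ m ih =>
      obtain ⟨c, hc⟩ := ih
      rw [pow_succ', Module.End.mul_apply, hc, rightMul_single, add_assoc, ← Pi.single_add]
      split_ifs
      · exact ⟨_, rfl⟩
      · exact ⟨0, by simp⟩
  obtain ⟨m, hm⟩ : ∃ m, D.N i = m + 1 := ⟨D.N i - 1, by have := D.one_lt_N i; omega⟩
  ext1 u
  ext1
  obtain ⟨c, hc⟩ := key m u
  simp only [LinearMap.comp_apply, Finsupp.lsingle_apply]
  -- The last of the N_i steps would bring the exponent of x_i to at least N_i, where `rightMul` is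
  -- zero.
  rw [hm, pow_succ', Module.End.mul_apply, hc, rightMul_single, if_neg]
  · rfl
  · intro h
    have := h i
    simp at this
    omega

/-- The right action of `S` on formal monomials. -/
def rightAction : D.S →ₐ[k] (Module.End k ((Fin D.n → ℕ) →₀ k))ᵐᵒᵖ :=
  RingQuot.liftAlgHom k ⟨FreeAlgebra.lift k fun j => MulOpposite.op (D.rightMul j), by
    intro a b h
    cases h with
    | comm i j h =>
      simp only [map_mul, FreeAlgebra.lift_ι_apply, map_smul]
      rw [← MulOpposite.op_mul, D.rightMul_comm i j h]
      rfl
    | pow i =>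
      simp only [map_pow, FreeAlgebra.lift_ι_apply, map_zero]
      rw [← MulOpposite.op_pow, rightMul_pow, MulOpposite.op_zero]⟩

/-- The linear map `S → k^(ℕⁿ)` which sends `X u` to the formal monomial `u`. -/
def toFormal : D.S →ₗ[k] ((Fin D.n → ℕ) →₀ k) where
  toFun s := (D.rightAction s).unop (Finsupp.single 0 1)
  map_add' := by simp
  map_smul' := by simp

lemma toFormal_mul_x (s : D.S) (j : Fin D.n) :
    D.toFormal (s * D.x j) = D.rightMul j (D.toFormal s) := by
  simp [toFormal, rightAction, x]

/-- Induction on total degree: X^{v+e_j} is a nonzero multiple of X^v x_j, and `rightMul` was given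
the scalar that cancels this multiple. -/
lemma toFormal_X (u : Fin D.n → ℕ) (h : D.Admissible u) :
    D.toFormal (D.X u) = Finsupp.single u 1 := by
  classical
  induction hm : ∑ i, u i generalizing u with
  | zero =>
    have : u = 0 := by
      ext i
      simpa using (Finset.sum_eq_zero_iff.mp hm) i
    subst this
    rw [X_zero]
    simp [toFormal]
  | succ m ih =>
    obtain ⟨j, hj⟩ : ∃ j, u j ≠ 0 := by
      by_contra! h0
      simp [h0] at hm
    obtain ⟨v, rfl⟩ : ∃ v, u = v + Pi.single j 1 :=
      ⟨u - Pi.single j 1, (sub_single_add_single (by omega)).symm⟩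
    have e := D.X_mul_x v j
    rw [← inv_smul_eq_iff₀ (D.qX_ne_zero v j)] at e
    rw [← e, map_smul, toFormal_mul_x, ih v (Admissible.of_add D h), rightMul_single, if_pos h]
    · simp [D.qX_ne_zero v j]
    · simp [Finset.sum_add_distrib] at hm
      exact hm

lemma span_X : Submodule.span k (Set.range fun u : {u // D.Admissible u} => D.X u.1) = ⊤ := by
  apply Submodule.eq_top_of_mul_mem (RingQuot.adjoin_range_mkAlgHom_ι D.Rel)
  · refine Submodule.subset_span ⟨⟨0, fun i => ?_⟩, D.X_zero⟩
    have := D.one_lt_N i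
    simp; omega
  · rintro _ ⟨j, rfl⟩ w hw
    induction hw using Submodule.span_induction with
    | mem w hw =>
      obtain ⟨u, rfl⟩ := hw
      change D.X u.1 * D.x j ∈ _
      rw [X_mul_x]
      apply Submodule.smul_mem
      by_cases h : D.Admissible (u.1 + Pi.single j 1)
      · exact Submodule.subset_span ⟨⟨_, h⟩, rfl⟩
      · rw [D.X_eq_zero h]
        exact Submodule.zero_mem _
    | zero => simp
    | add a b _ _ ha hb =>
      rw [add_mul]
      exact Submodule.add_mem _ ha hb
    | smul c a _ ha =>
      rw [smul_mul_assoc]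
      exact Submodule.smul_mem _ c ha

/-- The basis of `S` formed by the ordered monomials with admissible exponents. -/
def basisX : Module.Basis {u // D.Admissible u} k D.S :=
  Module.Basis.mk (v := fun u => D.X u.1) (by
    -- Independence is tested on formal monomials, where the images are distinct basis vectors.
    apply LinearIndependent.of_comp D.toFormal
    have : (⇑D.toFormal ∘ fun u : {u // D.Admissible u} => D.X u.1) =
        (fun u : Fin D.n → ℕ => Finsupp.single u (1 : k)) ∘ Subtype.val := by
      ext1 u
      exact D.toFormal_X u.1 u.2
    rw [this]
    exact (Finsupp.linearIndependent_single_one k _).comp _ Subtype.val_injective) D.span_X.ge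

lemma basisX_apply (u : {u // D.Admissible u}) : D.basisX u = D.X u.1 := by
  simp [basisX]

end QuantumData

/-! ### The twisted tensor product complex and its contracting homotopy -/

namespace QuantumData

variable {k : Type u} [Field k] (D : QuantumData k)

lemma sigma_of_le {i : Fin D.n} (h : D.t ≤ (i : ℕ)) (a : ℕ) : D.sigma i a = 1 :=
  dif_neg h.not_gt

lemma inc_mk {i : Fin D.n} (h : (i : ℕ) < D.t) : D.inc ⟨i, h⟩ = i := rfl

lemma inc_injective : Function.Injective D.inc := Fin.castLE_injective D.t_le

lemma sigma_inc (i : Fin D.t) (a : ℕ) :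
    D.sigma (D.inc i) a = if Odd a then 1 else D.N i - 1 :=
  dif_pos i.2

lemma sigma_of_odd (i : Fin D.n) {a : ℕ} (h : Odd a) : D.sigma i a = 1 := by
  simp [sigma, h]

lemma sigma_pos (i : Fin D.n) (a : ℕ) : 0 < D.sigma i a := by
  unfold sigma
  split_ifs with h _
  · exact one_pos
  · have := D.one_lt_N ⟨i, h⟩
    omega
  · exact one_pos

/-- Two successive differentials in one truncated variable multiply by x_i^{N_i} = 0, while the
complementary exponents also give exactness. -/
lemma sigma_add_sigma (i : Fin D.t) (a : ℕ) :
    D.sigma (D.inc i) a + D.sigma (D.inc i) (a + 1) = D.N i := by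
  have := D.one_lt_N i
  rw [sigma_inc, sigma_inc]
  rcases Nat.even_or_odd a with h | h
  · rw [if_neg (Nat.not_odd_iff_even.mpr h), if_pos h.add_one]
    omega
  · rw [if_pos h, if_neg (Nat.not_odd_iff_even.mpr h.add_one)]
    omega

lemma tau_zero (i : Fin D.n) : D.tau i 0 = 0 := rfl

lemma tau_succ (i : Fin D.n) (a : ℕ) : D.tau i (a + 1) = D.tau i a + D.sigma i (a + 1) :=
  Finset.sum_Icc_succ_top (by omega) _

/-- The condition for `a` to index a generator of `K_m`. -/
def IsIndex (m : ℕ) (a : Fin D.n → ℕ) : Prop :=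
  (∀ i : Fin D.n, D.t ≤ (i : ℕ) → a i ≤ 1) ∧ ∑ i, a i = m

variable {D}

lemma IsIndex.sub_single {m : ℕ} {a : Fin D.n → ℕ} (ha : D.IsIndex (m + 1) a) {i : Fin D.n}
    (hi : 0 < a i) : D.IsIndex m (a - Pi.single i 1) := by
  refine ⟨fun j hj => le_trans (by simp) (ha.1 j hj), ?_⟩
  have h1 := ha.2
  rw [← sub_single_add_single (Nat.one_le_iff_ne_zero.mpr hi.ne')] at h1
  simpa [Finset.sum_add_distrib] using h1

lemma IsIndex.add_single {m : ℕ} {a : Fin D.n → ℕ} (ha : D.IsIndex m a) {i : Fin D.n}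
    (hi : D.t ≤ (i : ℕ) → a i = 0) : D.IsIndex (m + 1) (a + Pi.single i 1) := by
  refine ⟨fun j hj => ?_, by simp [Finset.sum_add_distrib, ha.2]⟩
  by_cases h : j = i
  · subst h
    simp [hi hj]
  · simpa [h] using ha.1 j hj

variable (D)

variable {D} in
/-- The tuple underlying an index. -/
def Index.tuple {m : ℕ} (a : D.Index m) : Fin D.n → ℕ := a.1

variable {D} in
/-- The index attached to a tuple. -/
def IsIndex.index {m : ℕ} {a : Fin D.n → ℕ} (h : D.IsIndex m a) : D.Index m := ⟨a, h⟩

variable {D} in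
@[simp] lemma IsIndex.tuple_index {m : ℕ} {a : Fin D.n → ℕ} (h : D.IsIndex m a) :
    h.index.tuple = a := rfl

variable {D} in
lemma Index.isIndex {m : ℕ} (a : D.Index m) : D.IsIndex m a.tuple := a.2

/-- The free module `K_m`. -/
abbrev K (m : ℕ) : Type u := D.Index m →₀ D.S

open Classical in
/-- The generator `Φ(a)` of `K_m`, extended by zero to all tuples. -/
def Phi (m : ℕ) (a : Fin D.n → ℕ) : D.K m :=
  -- The zero value outside the index set also terminates the contraction for i > t, where a_i
  -- cannot exceed 1.
  if h : D.IsIndex m a then Finsupp.single h.index 1 else 0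

lemma Phi_index {m : ℕ} (a : D.Index m) : D.Phi m a.tuple = Finsupp.single a 1 :=
  dif_pos a.isIndex

lemma Phi_of_isIndex {m : ℕ} {a : Fin D.n → ℕ} (h : D.IsIndex m a) :
    D.Phi m a = Finsupp.single h.index 1 :=
  dif_pos h

lemma Phi_eq_zero {m : ℕ} {a : Fin D.n → ℕ} (h : ¬ D.IsIndex m a) : D.Phi m a = 0 :=
  dif_neg h

/-- The differential `K_{m+1} → K_m`. -/
def diff (m : ℕ) : D.K (m + 1) →ₗ[D.S] D.K m :=
  Finsupp.linearCombination D.S fun a : D.Index (m + 1) =>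
    ∑ i, if 0 < a.tuple i then
      (D.dCoeff a.tuple i • D.x i ^ D.sigma i (a.tuple i)) • D.Phi m (a.tuple - Pi.single i 1) else 0

lemma diff_Phi {m : ℕ} {a : Fin D.n → ℕ} (ha : D.IsIndex (m + 1) a) :
    D.diff m (D.Phi (m + 1) a) =
      ∑ i, if 0 < a i then
        (D.dCoeff a i • D.x i ^ D.sigma i (a i)) • D.Phi m (a - Pi.single i 1) else 0 := by
  rw [Phi_of_isIndex D ha, diff, Finsupp.linearCombination_single, one_smul,
    ha.tuple_index]

lemma diff_X_smul_Phi {m : ℕ} {a : Fin D.n → ℕ} (ha : D.IsIndex (m + 1) a) (u : Fin D.n → ℕ) :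
    D.diff m (D.X u • D.Phi (m + 1) a) =
      ∑ i, if 0 < a i then
        (D.dCoeff a i * D.qX u i ^ D.sigma i (a i)) •
          (D.X (u + Pi.single i (D.sigma i (a i))) • D.Phi m (a - Pi.single i 1)) else 0 := by
  rw [map_smul, diff_Phi D ha, Finset.smul_sum]
  refine Finset.sum_congr rfl fun i _ => ?_
  rw [smul_ite, smul_zero, smul_smul, mul_smul_comm, X_mul_x_pow, smul_smul, smul_assoc]

/-- `i` is the largest index at which one of the tuples `u`, `a` is nonzero. -/
def IsTop (u a : Fin D.n → ℕ) (i : Fin D.n) : Prop :=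
  (u i ≠ 0 ∨ a i ≠ 0) ∧ ∀ l, i < l → u l = 0 ∧ a l = 0

variable {D}

lemma IsTop.unique {u a : Fin D.n → ℕ} {i j : Fin D.n} (hi : D.IsTop u a i) (hj : D.IsTop u a j) :
    i = j := by
  rcases lt_trichotomy i j with h | h | h
  · have := hi.2 j h
    have := hj.1
    omega
  · exact h
  · have := hj.2 i h
    have := hi.1
    omega

lemma exists_isTop {u a : Fin D.n → ℕ} (h : u ≠ 0 ∨ a ≠ 0) : ∃ i, D.IsTop u a i := by
  classical
  let s : Finset (Fin D.n) := Finset.univ.filter fun i => u i ≠ 0 ∨ a i ≠ 0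
  have hs : s.Nonempty := by
    rcases h with h | h
    · obtain ⟨i, hi⟩ := Function.ne_iff.mp h
      exact ⟨i, by simpa [s] using Or.inl hi⟩
    · obtain ⟨i, hi⟩ := Function.ne_iff.mp h
      exact ⟨i, by simpa [s] using Or.inr hi⟩
  refine ⟨s.max' hs, by simpa [s] using s.max'_mem hs, fun l hl => ?_⟩
  by_contra hc
  have : l ∈ s := by
    simp only [s, Finset.mem_filter, Finset.mem_univ, true_and]
    omega
  exact absurd (s.le_max' l this) hl.not_ge

variable (D)

open Classical in
/-- The value of the contracting homotopy on `X u • Φ(a)`. -/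
def homotopyValue (m : ℕ) (u a : Fin D.n → ℕ) : D.K (m + 1) :=
  -- This is the one-variable contraction in the last active variable. All entries to its right are
  -- zero, so the differential has coefficient 1 there and no correcting scalar occurs.
  if h : ∃ i, D.IsTop u a i ∧ D.sigma i (a i + 1) ≤ u i then
    D.X (u - Pi.single h.choose (D.sigma h.choose (a h.choose + 1))) •
      D.Phi (m + 1) (a + Pi.single h.choose 1)
  else 0

lemma homotopyValue_of_isTop {m : ℕ} {u a : Fin D.n → ℕ} {i : Fin D.n} (hi : D.IsTop u a i) :
    D.homotopyValue m u a = if D.sigma i (a i + 1) ≤ u i then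
      D.X (u - Pi.single i (D.sigma i (a i + 1))) • D.Phi (m + 1) (a + Pi.single i 1) else 0 := by
  unfold homotopyValue
  split_ifs with h1 h2 h2
  · rw [hi.unique h1.choose_spec.1]
  · rw [hi.unique h1.choose_spec.1] at h2
    exact absurd h1.choose_spec.2 h2
  · exact absurd ⟨i, hi, h2⟩ h1
  · rfl

/-- The contracting homotopy of the complex `K`. -/
def homotopy (m : ℕ) : D.K m →ₗ[k] D.K (m + 1) :=
  Finsupp.lsum k fun a : D.Index m => D.basisX.constr k fun u => D.homotopyValue m u.1 a.tuple

lemma homotopy_X_smul_Phi {m : ℕ} {u a : Fin D.n → ℕ} (hu : D.Admissible u)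
    (ha : D.IsIndex m a) : D.homotopy m (D.X u • D.Phi m a) = D.homotopyValue m u a := by
  rw [Phi_of_isIndex D ha, homotopy, Finsupp.smul_single, smul_eq_mul, mul_one,
    Finsupp.lsum_single, ← D.basisX_apply ⟨u, hu⟩, Module.Basis.constr_basis,
    ha.tuple_index]

/-- Two `k`-linear maps on `K_m` agree when they agree on all `X u • Φ(a)`. -/
lemma K_hom_ext {m : ℕ} {M : Type*} [AddCommMonoid M] [Module k M] (f g : D.K m →ₗ[k] M)
    (h : ∀ u a, D.Admissible u → D.IsIndex m a → f (D.X u • D.Phi m a) = g (D.X u • D.Phi m a)) :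
    f = g := by
  ext1 a
  apply D.basisX.ext
  intro u
  have := h u.1 a.tuple u.2 a.isIndex
  rw [Phi_index, Finsupp.smul_single, smul_eq_mul, mul_one] at this
  simpa [basisX_apply] using this

lemma dCoeff_eq_one {a : Fin D.n → ℕ} {i : Fin D.n} (hi : ∀ l, i < l → a l = 0) :
    D.dCoeff a i = 1 := by
  apply Finset.prod_eq_one
  intro l hl
  rw [hi l (by simpa using hl)]
  simp [tau_zero]

end QuantumData

/-! ### The homotopy identity on monomials -/

namespace QuantumData

variable {k : Type u} [Field k] (D : QuantumData k)

lemma dCoeff_eq (a : Fin D.n → ℕ) (i : Fin D.n) :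
    D.dCoeff a i = ∏ l, if i < l then
      ((-1) ^ a l * D.q l i ^ (D.sigma i (a i) * D.tau l (a l))) else 1 :=
  Finset.prod_filter _ _

/-- Raising an entry to the right of `j` changes the coefficient of the differential at `j`. -/
lemma dCoeff_add_single {a : Fin D.n → ℕ} {i j : Fin D.n} (h : j < i) :
    D.dCoeff (a + Pi.single i 1) j =
      -(D.q i j ^ (D.sigma j (a j) * D.sigma i (a i + 1))) * D.dCoeff a j := by
  rw [dCoeff_eq, dCoeff_eq, ← Finset.mul_prod_erase _ _ (Finset.mem_univ i),
    ← Finset.mul_prod_erase Finset.univ (fun l => if j < l then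
      ((-1) ^ a l * D.q l j ^ (D.sigma j (a j) * D.tau l (a l))) else 1) (Finset.mem_univ i),
    ← mul_assoc]
  congr 1
  · simp only [h, if_true, Pi.add_apply, Pi.single_eq_same, tau_succ, Pi.single_eq_of_ne h.ne,
      add_zero, mul_add, pow_add]
    ring
  · refine Finset.prod_congr rfl fun l hl => ?_
    simp [Finset.ne_of_mem_erase hl, h.ne]

/-- The coefficient of the differential at `j` does not depend on the entries to the left. -/
lemma dCoeff_congr {a b : Fin D.n → ℕ} {j : Fin D.n} (h : ∀ l, j ≤ l → a l = b l) :
    D.dCoeff a j = D.dCoeff b j := by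
  unfold dCoeff
  refine Finset.prod_congr rfl fun l hl => ?_
  rw [h l (by simpa using (Finset.mem_filter.mp hl).2.le), h j le_rfl]

open Classical in
/-- `d ∘ h` on `X u • Φ(a)`, as a sum over all indices. -/
lemma diff_homotopy {m : ℕ} {u a : Fin D.n → ℕ} (hu : D.Admissible u) (ha : D.IsIndex m a)
    {i : Fin D.n} (hi : D.IsTop u a i) :
    D.diff m (D.homotopy m (D.X u • D.Phi m a)) =
      ∑ j, if D.sigma i (a i + 1) ≤ u i ∧ D.IsIndex (m + 1) (a + Pi.single i 1) ∧
          0 < (a + Pi.single i 1 : Fin D.n → ℕ) j then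
        (D.dCoeff (a + Pi.single i 1 : Fin D.n → ℕ) j *
          D.qX (u - Pi.single i (D.sigma i (a i + 1))) j ^
            D.sigma j ((a + Pi.single i 1 : Fin D.n → ℕ) j)) •
          (D.X (u - Pi.single i (D.sigma i (a i + 1)) +
            Pi.single j (D.sigma j ((a + Pi.single i 1 : Fin D.n → ℕ) j))) •
              D.Phi m (a + Pi.single i 1 - Pi.single j 1)) else 0 := by
  rw [homotopy_X_smul_Phi D hu ha, homotopyValue_of_isTop D hi]
  by_cases h1 : D.sigma i (a i + 1) ≤ u i
  · rw [if_pos h1]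
    by_cases h2 : D.IsIndex (m + 1) (a + Pi.single i 1)
    · rw [diff_X_smul_Phi D h2]
      simp [h1, h2]
    · simp [Phi_eq_zero D h2, h2]
  · simp [h1]

/-- An overflow created at j is not repaired by lowering the exponent at another index; hence
overflow terms drop out of dh and hd simultaneously. -/
lemma not_admissible_sub {u : Fin D.n → ℕ} {i j : Fin D.n} (hij : j ≠ i) {s r : ℕ}
    (hu : D.Admissible u) (h : ¬ D.Admissible (u + Pi.single j s)) :
    ¬ D.Admissible (u - Pi.single i r + Pi.single j s) := by
  contrapose! h
  intro l
  have h1 := h l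
  by_cases hl : D.inc l = j
  · subst hl
    simpa [hij] using h1
  · simpa [hl] using hu l

/-- Changes to the left of the top index do not move it, so `homotopy` uses the same variable before
and after a differential in direction j < i. -/
lemma IsTop.of_lt {u a : Fin D.n → ℕ} {i : Fin D.n} (hi : D.IsTop u a i) {j : Fin D.n}
    (hj : j < i) (s r : ℕ) : D.IsTop (u + Pi.single j s) (a - Pi.single j r) i := by
  refine ⟨by simpa [hj.ne'] using hi.1, fun l hl => ?_⟩
  have := hi.2 l hl
  simp [this, (hj.trans hl).ne']

/-- The contribution of an index `j < i` to `h ∘ d`, where `i` is the top index. -/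
lemma homotopy_of_lt {m : ℕ} {u a : Fin D.n → ℕ} (hu : D.Admissible u)
    (ha : D.IsIndex (m + 1) a) {i : Fin D.n} (hi : D.IsTop u a i) {j : Fin D.n} (hj : j < i)
    (haj : 0 < a j) (s : ℕ) :
    D.homotopy m (D.X (u + Pi.single j s) • D.Phi m (a - Pi.single j 1)) =
      if D.sigma i (a i + 1) ≤ u i then
        D.X (u - Pi.single i (D.sigma i (a i + 1)) + Pi.single j s) •
          D.Phi (m + 1) (a + Pi.single i 1 - Pi.single j 1) else 0 := by
  by_cases h : D.Admissible (u + Pi.single j s)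
  · rw [homotopy_X_smul_Phi D h (ha.sub_single haj),
      homotopyValue_of_isTop D (IsTop.of_lt D hi hj s 1)]
    simp only [Pi.add_apply, Pi.sub_apply, Pi.single_eq_of_ne hj.ne', add_zero, tsub_zero]
    have e1 : u + Pi.single j s - Pi.single i (D.sigma i (a i + 1)) =
        u - Pi.single i (D.sigma i (a i + 1)) + Pi.single j s := by
      ext l
      by_cases hl : l = i
      · subst hl; simp [hj.ne']
      · simp [hl]
    have e2 : a - Pi.single j 1 + Pi.single i 1 = a + Pi.single i 1 - Pi.single j 1 := by
      ext l
      by_cases hl : l = i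
      · subst hl; simp [hj.ne']
      · simp [hl]
    rw [e1, e2]
  · rw [D.X_eq_zero h, D.X_eq_zero (D.not_admissible_sub hj.ne hu h)]
    simp

lemma homotopy_top {m : ℕ} {u a : Fin D.n → ℕ} (ha : D.IsIndex (m + 1) a) {i : Fin D.n}
    (hi : D.IsTop u a i) (hai : 0 < a i)
    (h : D.Admissible (u + Pi.single i (D.sigma i (a i)))) :
    D.homotopy m (D.X (u + Pi.single i (D.sigma i (a i))) • D.Phi m (a - Pi.single i 1)) =
      D.X u • D.Phi (m + 1) a := by
  have ht : D.IsTop (u + Pi.single i (D.sigma i (a i))) (a - Pi.single i 1) i := by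
    refine ⟨Or.inl ?_, fun l hl => ?_⟩
    · have := D.sigma_pos i (a i)
      simp; omega
    · have := hi.2 l hl
      simp [this, hl.ne']
  have e : (a - Pi.single i 1 : Fin D.n → ℕ) i + 1 = a i := by
    simp; omega
  rw [homotopy_X_smul_Phi D h (ha.sub_single hai), homotopyValue_of_isTop D ht, e,
    if_pos (by simp), sub_single_add_single hai, add_tsub_cancel_right]

/-- Exactly one of the two contributions of the top index is nonzero. -/
lemma top_alternative {m : ℕ} {u a : Fin D.n → ℕ} (hu : D.Admissible u) (ha : D.IsIndex m a)
    {i : Fin D.n} (hi : D.IsTop u a i) :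
    (D.sigma i (a i + 1) ≤ u i ∧ D.IsIndex (m + 1) (a + Pi.single i 1)) ↔
      ¬ (0 < a i ∧ D.Admissible (u + Pi.single i (D.sigma i (a i)))) := by
  by_cases hit : (i : ℕ) < D.t
  · obtain ⟨i, rfl⟩ : ∃ i', D.inc i' = i := ⟨⟨i, hit⟩, rfl⟩
    have hb : D.IsIndex (m + 1) (a + Pi.single (D.inc i) 1) :=
      ha.add_single fun h => absurd hit h.not_gt
    have hA : D.Admissible (u + Pi.single (D.inc i) (D.sigma (D.inc i) (a (D.inc i)))) ↔
        u (D.inc i) + D.sigma (D.inc i) (a (D.inc i)) < D.N i := by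
      refine ⟨fun h => by simpa using h i, fun h l => ?_⟩
      by_cases hl : l = i
      · subst hl; simpa using h
      · have hl : D.inc l ≠ D.inc i := fun h' => hl (D.inc_injective h')
        simpa [hl] using hu l
    rw [hA]
    -- For a_i > 0 this turns u_i ≥ σ_i(a_i+1) into u_i + σ_i(a_i) ≥ N_i. For a_i = 0, being the top
    -- index forces u_i ≥ 1 = σ_i(1).
    have h1 := D.sigma_add_sigma i (a (D.inc i))
    have h2 := hi.1
    rcases Nat.eq_zero_or_pos (a (D.inc i)) with h0 | h0
    · have := D.sigma_of_odd (D.inc i) (a := a (D.inc i) + 1) (by simp [h0])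
      simp only [hb, and_true]
      omega
    · simp only [hb, and_true]
      omega
  · rw [not_lt] at hit
    have hA : D.Admissible (u + Pi.single i (D.sigma i (a i))) := by
      intro l
      have hl : D.inc l ≠ i := by
        rintro rfl
        exact absurd l.2 hit.not_gt
      simpa [hl] using hu l
    -- For an untruncated variable a_i is 0 or 1: the first allows raising a_i since then u_i > 0,
    -- the second allows lowering it.
    have h1 := ha.1 i hit
    have h2 := hi.1
    rw [sigma_of_le D hit]
    simp only [hA, and_true]
    constructor
    · rintro ⟨_, h⟩ h3
      have := h.1 i hit
      simp at this
      omega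
    · intro h
      exact ⟨by omega, ha.add_single fun _ => by omega⟩

lemma IsIndex.ne_zero {m : ℕ} {a : Fin D.n → ℕ} (ha : D.IsIndex (m + 1) a) : a ≠ 0 := by
  rintro rfl
  simpa using ha.2

/-- Compare dh and hd direction by direction, relative to the top index i: direction i reproduces
the element through exactly one of the two composites, directions j < i cancel, and directions j > i
are empty. -/
theorem diff_homotopy_add_homotopy_diff {m : ℕ} {u a : Fin D.n → ℕ} (hu : D.Admissible u)
    (ha : D.IsIndex (m + 1) a) :
    D.diff (m + 1) (D.homotopy (m + 1) (D.X u • D.Phi (m + 1) a)) +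
      D.homotopy m (D.diff m (D.X u • D.Phi (m + 1) a)) = D.X u • D.Phi (m + 1) a := by
  classical
  obtain ⟨i, hi⟩ := exists_isTop (D := D) (u := u) (Or.inr (IsIndex.ne_zero D ha))
  rw [diff_homotopy D hu ha hi, diff_X_smul_Phi D ha, map_sum, ← Finset.sum_add_distrib,
    Finset.sum_eq_single i]
  · have hd : ∀ {b : Fin D.n → ℕ}, (∀ l, i < l → b l = 0) → D.dCoeff b i = 1 := D.dCoeff_eq_one
    have hq : ∀ {b : Fin D.n → ℕ}, (∀ l, i < l → b l = 0) → D.qX b i = 1 := by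
      intro b hb
      refine Finset.prod_eq_one fun l hl => ?_
      rw [hb l (by simpa using hl), pow_zero]
    rw [hd (fun l hl => by simp [(hi.2 l hl).2, hl.ne']), hd (fun l hl => (hi.2 l hl).2),
      hq (fun l hl => by simp [(hi.2 l hl).1]), hq (fun l hl => (hi.2 l hl).1)]
    simp only [one_pow, mul_one, one_smul, Pi.add_apply, Pi.single_eq_same, Nat.succ_pos,
      and_true, add_tsub_cancel_right]
    have alt := D.top_alternative hu ha hi
    by_cases h : D.sigma i (a i + 1) ≤ u i ∧ D.IsIndex (m + 1 + 1) (a + Pi.single i 1)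
    · have h' := alt.mp h
      rw [if_pos h, sub_single_add_single h.1]
      split_ifs with h0
      · rw [D.X_eq_zero (fun hc => h' ⟨h0, hc⟩)]
        simp
      · simp
    · have h' := not_not.mp (mt alt.mpr h)
      rw [if_neg h, if_pos h'.1, homotopy_top D ha hi h'.1 h'.2, zero_add]
  · intro j _ hj
    rcases lt_or_gt_of_ne hj with hj | hj
    · simp only [Pi.add_apply, Pi.single_eq_of_ne hj.ne, add_zero]
      by_cases h0 : 0 < a j
      · rw [if_pos h0, map_smul, homotopy_of_lt D hu ha hi hj h0]
        by_cases h1 : D.sigma i (a i + 1) ≤ u i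
        · by_cases h2 : D.IsIndex (m + 1 + 1) (a + Pi.single i 1)
          · rw [if_pos ⟨h1, h2, h0⟩, if_pos h1, ← add_smul, dCoeff_add_single D hj]
            -- The factor of x_i removed by `homotopy` is crossed by x_j in hd but not in dh; the
            -- resulting power of q_ij is the one by which raising a_i changes the coefficient of d,
            -- up to the sign that makes the terms cancel.
            have e : D.qX u j = D.qX (u - Pi.single i (D.sigma i (a i + 1))) j *
                D.q i j ^ D.sigma i (a i + 1) := by
              conv_lhs => rw [← sub_single_add_single h1]
              rw [qX_add, qX_single, if_pos hj]
            convert zero_smul k _ using 2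
            rw [e, mul_pow, ← pow_mul, mul_comm (D.sigma i _)]
            ring
          · have h3 : ¬ D.IsIndex (m + 1) (a + Pi.single i 1 - Pi.single j 1) := by
              contrapose! h2
              have hji : (a + Pi.single i 1 : Fin D.n → ℕ) j = a j := by simp [hj.ne]
              refine ha.add_single fun hit => ?_
              have := h2.1 i hit
              simp [hj.ne'] at this
              omega
            rw [if_neg (by tauto), Phi_eq_zero D h3]
            simp
        · simp [h1]
      · simp [h0]
    · simp [hj.ne', (hi.2 j hj).2]
  · simp

/-- With a = 0 nothing can be lowered, so `top_alternative` leaves only the raising term. -/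
lemma diff_homotopy_zero {u : Fin D.n → ℕ} (hu : D.Admissible u) (h : u ≠ 0) :
    D.diff 0 (D.homotopy 0 (D.X u • D.Phi 0 0)) = D.X u • D.Phi 0 0 := by
  classical
  have ha : D.IsIndex 0 0 := ⟨by simp, by simp⟩
  obtain ⟨i, hi⟩ := exists_isTop (D := D) (a := 0) (Or.inl h)
  have alt := (D.top_alternative hu ha hi).mpr (by simp)
  rw [diff_homotopy D hu ha hi, Finset.sum_eq_single i]
  · rw [if_pos ⟨alt.1, alt.2, by simp⟩, D.dCoeff_eq_one (fun l hl => by simp [hl.ne'])]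
    have hq : D.qX (u - Pi.single i (D.sigma i ((0 : Fin D.n → ℕ) i + 1))) i = 1 := by
      refine Finset.prod_eq_one fun l hl => ?_
      have := (hi.2 l (by simpa using hl)).1
      simp [this]
    have e : (0 + Pi.single i 1 : Fin D.n → ℕ) i = (0 : Fin D.n → ℕ) i + 1 := by simp
    rw [hq, one_pow, mul_one, one_smul, e, sub_single_add_single alt.1, add_tsub_cancel_right]
  · intro j _ hj
    simp [hj]
  · simp

lemma homotopy_X_zero : D.homotopy 0 (D.X 0 • D.Phi 0 0) = 0 := by
  have h0 : D.Admissible 0 := fun i => by have := D.one_lt_N i; simp; omega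
  rw [homotopy_X_smul_Phi D h0 ⟨by simp, by simp⟩, homotopyValue, dif_neg]
  rintro ⟨i, hi, -⟩
  simpa using hi.1

end QuantumData

/-! ### Exactness of the complex and the resolution of k -/

namespace QuantumData

variable {k : Type u} [Field k] (D : QuantumData k)

lemma homotopy_identity {m : ℕ} (z : D.K (m + 1)) :
    D.diff (m + 1) (D.homotopy (m + 1) z) + D.homotopy m (D.diff m z) = z := by
  have : ((D.diff (m + 1)).restrictScalars k ∘ₗ D.homotopy (m + 1)) +
      (D.homotopy m ∘ₗ (D.diff m).restrictScalars k) = LinearMap.id := by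
    apply D.K_hom_ext
    intro u a hu ha
    exact D.diff_homotopy_add_homotopy_diff hu ha
  exact LinearMap.congr_fun this z

lemma toField_smul (s : D.S) (m : D.trivialModule) :
    D.toField (s • m) = D.aug s * D.toField m := rfl

/-- The element `1` of the trivial module. -/
def one : D.trivialModule := (1 : k)

/-- The augmentation `K_0 → k`. -/
def augK : D.K 0 →ₗ[D.S] D.trivialModule :=
  Finsupp.linearCombination D.S fun _ => D.one

lemma isIndex_zero : D.IsIndex 0 0 := ⟨by simp, by simp⟩

lemma IsIndex.eq_zero {a : Fin D.n → ℕ} (h : D.IsIndex 0 a) : a = 0 := by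
  ext i
  simpa using (Finset.sum_eq_zero_iff.mp h.2) i

lemma toField_augK_single (a : D.Index 0) (s : D.S) :
    D.toField (D.augK (Finsupp.single a s)) = D.aug s := by
  rw [augK, Finsupp.linearCombination_single, toField_smul]
  exact mul_one _

lemma toField_augK_smul_Phi (s : D.S) : D.toField (D.augK (s • D.Phi 0 0)) = D.aug s := by
  rw [D.Phi_of_isIndex D.isIndex_zero, Finsupp.smul_single, toField_augK_single, smul_eq_mul,
    mul_one]

lemma aug_x_pow_sigma (i : Fin D.n) (a : ℕ) : D.aug (D.x i ^ D.sigma i a) = 0 := by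
  rw [map_pow, aug_x, zero_pow (D.sigma_pos i a).ne']

lemma aug_X {u : Fin D.n → ℕ} (h : u ≠ 0) : D.aug (D.X u) = 0 := by
  obtain ⟨i, hi⟩ := Function.ne_iff.mp h
  rw [X, orderedMonomial, map_list_prod]
  apply List.prod_eq_zero
  rw [List.map_ofFn, List.mem_ofFn]
  exact ⟨i, by simpa [aug_x] using hi⟩

lemma toField_injective {m m' : D.trivialModule} (h : D.toField m = D.toField m') : m = m' := h

/-- Every linear map from a free module to the trivial module kills the image of `diff`. -/
lemma apply_diff_eq_zero {m : ℕ} (f : D.K m →ₗ[D.S] D.trivialModule) (z : D.K (m + 1)) :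
    f (D.diff m z) = 0 := by
  have : f ∘ₗ D.diff m = 0 := by
    ext1 a
    ext1
    rw [LinearMap.comp_apply, LinearMap.comp_apply, Finsupp.lsingle_apply, ← Phi_index,
      diff_Phi D a.isIndex, map_sum]
    refine Finset.sum_eq_zero fun i _ => ?_
    split_ifs
    · rw [map_smul]
      apply D.toField_injective
      rw [toField_smul, map_smul, aug_x_pow_sigma, smul_zero, zero_mul]
      rfl
    · exact map_zero f
  exact LinearMap.congr_fun this z

lemma homotopy_identity_zero (z : D.K 0) :
    D.diff 0 (D.homotopy 0 z) + D.toField (D.augK z) • D.Phi 0 0 = z := by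
  let f : D.K 0 →ₗ[k] k :=
    { toFun := fun z => D.toField (D.augK z)
      map_add' := fun a b => by rw [map_add]; rfl
      map_smul' := fun c a => by
        rw [← algebraMap_smul D.S c a, map_smul, toField_smul]
        simp }
  have : ((D.diff 0).restrictScalars k ∘ₗ D.homotopy 0) + f.smulRight (D.Phi 0 0) =
      LinearMap.id := by
    apply D.K_hom_ext
    intro u a hu ha
    obtain rfl := IsIndex.eq_zero D ha
    change D.diff 0 (D.homotopy 0 (D.X u • D.Phi 0 0)) +
      D.toField (D.augK (D.X u • D.Phi 0 0)) • D.Phi 0 0 = D.X u • D.Phi 0 0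
    rw [toField_augK_smul_Phi]
    by_cases h : u = 0
    · subst h
      rw [homotopy_X_zero, X_zero]
      simp
    · rw [diff_homotopy_zero D hu h, aug_X D h]
      simp
  exact LinearMap.congr_fun this z

/-- With i the top index, Φ(a) is recovered from x_i^{σ_i(a_i)} Φ(a-e_i). Thus the image of
`homotopy` contains all generators, which is what the proof of d² = 0 needs. -/
lemma exists_homotopy_eq_Phi {m : ℕ} {a : Fin D.n → ℕ} (ha : D.IsIndex (m + 1) a) :
    ∃ w, D.Phi (m + 1) a = D.homotopy m w := by
  obtain ⟨i, hi⟩ := exists_isTop (D := D) (u := 0) (Or.inr (IsIndex.ne_zero D ha))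
  have h0 : D.Admissible 0 := fun i => by have := D.one_lt_N i; simp; omega
  have hai : 0 < a i := by
    have := hi.1
    simp at this
    omega
  have hA : D.Admissible (0 + Pi.single i (D.sigma i (a i))) := by
    -- With u = 0 there is no factor of x_i to trade, so the raising alternative is impossible.
    by_contra hc
    have := (D.top_alternative h0 ha hi).mpr fun h => hc h.2
    have h1 := D.sigma_pos i (a i + 1)
    have h2 := this.1
    simp at h2
    omega
  refine ⟨D.X (0 + Pi.single i (D.sigma i (a i))) • D.Phi m (a - Pi.single i 1), ?_⟩
  rw [homotopy_top D ha hi hai hA, X_zero, one_smul]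

/-- If dhd = d on the boundaries, applying d to dh + hd = 1 gives ddh = 0, and the generators lie in
the image of h. The condition dhd = d follows from d² = 0 one degree lower, or from εd = 0 at the
start. -/
lemma diff_diff (m : ℕ) (z : D.K (m + 2)) : D.diff m (D.diff (m + 1) z) = 0 := by
  have step : ∀ m, (∀ w, D.diff m (D.homotopy m (D.diff m w)) = D.diff m w) →
      D.diff m ∘ₗ D.diff (m + 1) = 0 := by
    intro m h
    ext1 a
    ext1
    obtain ⟨w, hw⟩ := D.exists_homotopy_eq_Phi a.isIndex
    have := congrArg (D.diff m) (D.homotopy_identity w)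
    rw [map_add, h w] at this
    rw [LinearMap.comp_apply, Finsupp.lsingle_apply, ← Phi_index, hw, LinearMap.comp_apply,
      add_eq_right.mp this]
    rfl
  induction m with
  | zero =>
    refine LinearMap.congr_fun (step 0 fun w => ?_) z
    have := D.homotopy_identity_zero (D.diff 0 w)
    rw [D.apply_diff_eq_zero D.augK w] at this
    change _ + (0 : k) • _ = _ at this
    rwa [zero_smul, add_zero] at this
  | succ m ih =>
    refine LinearMap.congr_fun (step (m + 1) fun w => ?_) z
    have := D.homotopy_identity (D.diff (m + 1) w)
    rwa [ih, map_zero, add_zero] at this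

/-- The complex `K_•` of free `S`-modules. -/
def complex : ChainComplex (ModuleCat.{u} D.S) ℕ :=
  ChainComplex.of (fun m => ModuleCat.of D.S (D.K m)) (fun m => ModuleCat.ofHom (D.diff m))
    (fun m => by ext1; exact LinearMap.ext fun z => D.diff_diff m z)

lemma complex_d (m : ℕ) : D.complex.d (m + 1) m = ModuleCat.ofHom (D.diff m) :=
  ChainComplex.of_d (fun m => ModuleCat.of D.S (D.K m)) (fun m => ModuleCat.ofHom (D.diff m)) m

lemma complex_d_hom_apply (m : ℕ) (z : D.K (m + 1)) :
    (D.complex.d (m + 1) m).hom z = D.diff m z := by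
  rw [complex_d]
  rfl

/-- The augmentation of the complex `K_•`. -/
def complexπ : D.complex ⟶ (ChainComplex.single₀ _).obj D.trivialModule :=
  (ChainComplex.toSingle₀Equiv _ _).symm
    ⟨ModuleCat.ofHom (R := D.S) (X := D.K 0) (Y := D.trivialModule) D.augK, by
    rw [complex_d]
    ext1
    exact LinearMap.ext fun z => D.apply_diff_eq_zero D.augK z⟩

lemma complexπ_f_zero : D.complexπ.f 0 =
    ModuleCat.ofHom (R := D.S) (X := D.K 0) (Y := D.trivialModule) D.augK :=
  ChainComplex.toSingle₀Equiv_symm_apply_f_zero _ _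

lemma complexπ_f_zero_hom_apply (z : D.K 0) : (D.complexπ.f 0).hom z = D.augK z := by
  rw [complexπ_f_zero]
  rfl

lemma augK_smul_Phi (c : k) : D.augK (algebraMap k D.S c • D.Phi 0 0) = c :=
  D.toField_injective ((D.toField_augK_smul_Phi _).trans (AlgHom.commutes D.aug c))

instance projective_complex_X (m : ℕ) : Projective (D.complex.X m) :=
  ModuleCat.projective_of_free (M := ModuleCat.of D.S (D.K m)) Finsupp.basisSingleOne

/-- A cycle z satisfies z = d(hz), so the k-linear contraction yields exactness although h is not
S-linear. -/
lemma quasiIso_complexπ : QuasiIso D.complexπ where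
  quasiIsoAt m := by
    cases m with
    | zero =>
      rw [ChainComplex.quasiIsoAt₀_iff, ShortComplex.quasiIso_iff_of_zeros' _ rfl rfl rfl]
      constructor
      · rw [ShortComplex.moduleCat_exact_iff]
        intro z hz
        refine ⟨D.homotopy 0 z, ?_⟩
        have h1 := D.homotopy_identity_zero z
        have h2 : D.augK z = 0 := (D.complexπ_f_zero_hom_apply z).symm.trans hz
        have h3 : D.toField (D.augK z) = 0 := h2
        rw [h3, zero_smul, add_zero] at h1
        exact (D.complex_d_hom_apply 0 _).trans h1
      · rw [ModuleCat.epi_iff_surjective]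
        intro c
        exact ⟨algebraMap k D.S c • D.Phi 0 0,
          (D.complexπ_f_zero_hom_apply _).trans (D.augK_smul_Phi c)⟩
    | succ m =>
      rw [quasiIsoAt_iff_exactAt' (hL := ChainComplex.exactAt_succ_single_obj ..),
          HomologicalComplex.exactAt_iff' _ (m + 2) (m + 1) m (by simp) (by simp),
          ShortComplex.moduleCat_exact_iff]
      intro z hz
      refine ⟨D.homotopy (m + 1) z, ?_⟩
      have h1 := D.homotopy_identity z
      have h2 : D.diff m z = 0 := (D.complex_d_hom_apply m z).symm.trans hz
      rw [h2, map_zero, add_zero] at h1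
      exact (D.complex_d_hom_apply (m + 1) _).trans h1

/-- The complex `K_•` as a projective resolution of `k`. -/
def resolution : ProjectiveResolution D.trivialModule where
  complex := D.complex
  projective m := D.projective_complex_X m
  π := D.complexπ
  quasiIso := D.quasiIso_complexπ

lemma resolution_π_f_zero :
    D.resolution.π.f 0 ≫ (HomologicalComplex.singleObjXSelf _ 0 D.trivialModule).hom =
      ModuleCat.ofHom (R := D.S) (X := D.K 0) (Y := D.trivialModule) D.augK := by
  refine Eq.trans ?_ D.complexπ_f_zero
  exact Category.comp_id (D.complexπ.f 0)

lemma Phi_lower {m : ℕ} (a : D.Index (m + 1)) (i : Fin D.n) (h : 0 < a.1 i) :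
    D.Phi m (a.tuple - Pi.single i 1) = Finsupp.single (a.lower i h) 1 := by
  rw [← Phi_index]
  congr 1
  change _ = Function.update a.1 i (a.1 i - 1)
  ext j
  by_cases hj : j = i
  · subst hj
    simp [Index.tuple]
  · simp [hj, Index.tuple]

lemma diff_single {m : ℕ} (a : D.Index (m + 1)) :
    D.diff m (Finsupp.single a 1) = ∑ i, if h : 0 < a.1 i then
      (D.dCoeff a.1 i • D.x i ^ D.sigma i (a.1 i)) •
        (Finsupp.single (a.lower i h) 1 : D.K m) else 0 := by
  rw [← Phi_index, diff_Phi D a.isIndex]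
  refine Finset.sum_congr rfl fun i _ => ?_
  split_ifs with h1 h2 h2
  · rw [D.Phi_lower a i h1]
    rfl
  · exact absurd h1 h2
  · exact absurd h2 h1
  · rfl

/-- The twisted resolution. -/
def twistedResolution : D.TwistedResolution where
  res := D.resolution
  Φ m := (Finsupp.basisSingleOne : Module.Basis (D.Index m) D.S (D.K m))
  d_Φ m a := (D.complex_d_hom_apply m _).trans (D.diff_single a)
  aug_Φ a := by
    rw [resolution_π_f_zero]
    exact (D.toField_augK_single a 1).trans (map_one _)

end QuantumData

/-! ### Chain maps lifting the generators of the cohomology -/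

lemma Fintype.prod_eq_mul_prod_of_ne {ι M : Type*} [Fintype ι] [DecidableEq ι] [CommMonoid M]
    {f g : ι → M} {c : M} (j : ι) (hj : f j = c * g j) (h : ∀ l, l ≠ j → f l = g l) :
    ∏ l, f l = c * ∏ l, g l := by
  rw [← Finset.mul_prod_erase _ _ (Finset.mem_univ j), ← Finset.mul_prod_erase _ g
    (Finset.mem_univ j), hj, mul_assoc]
  congr 2
  exact Finset.prod_congr rfl fun l hl => h l (Finset.ne_of_mem_erase hl)

namespace QuantumData

variable {k : Type u} [Field k] (D : QuantumData k)

lemma sigma_add_two (i : Fin D.n) (a : ℕ) : D.sigma i (a + 2) = D.sigma i a := by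
  simp [sigma, Nat.odd_add]

/-- Raising the entry at `i` by two changes the coefficient of the differential at `j < i`. -/
lemma dCoeff_add_single_two {a : Fin D.n → ℕ} {i : Fin D.t} {j : Fin D.n} (h : j < D.inc i) :
    D.dCoeff (a + Pi.single (D.inc i) 2) j =
      D.q (D.inc i) j ^ (D.N i * D.sigma j (a j)) * D.dCoeff a j := by
  have e : (Pi.single (D.inc i) 2 : Fin D.n → ℕ) = Pi.single (D.inc i) 1 + Pi.single (D.inc i) 1 :=
    (Pi.single_add (D.inc i) 1 1)
  rw [e, ← add_assoc, dCoeff_add_single D h, dCoeff_add_single D h, ← mul_assoc, neg_mul_neg,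
    ← pow_add]
  simp only [Pi.add_apply, Pi.single_eq_same, Pi.single_eq_of_ne h.ne, add_zero]
  rw [← mul_add, add_comm (D.sigma (D.inc i) _), D.sigma_add_sigma, mul_comm (D.sigma j _)]

/-- The coefficients of the chain map lifting `ξᵢ`. -/
def xiCoeff (i : Fin D.t) (b : Fin D.n → ℕ) : k :=
  -- In the internal grading Φ(b) has x_l-degree τ_l(b_l) and Φ(2e_i) has x_i-degree N_i; the factor
  -- is the commutation scalar between them.
  ∏ l, if l < D.inc i then D.q (D.inc i) l ^ (D.N i * D.tau l (b l)) else 1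

lemma xiCoeff_ne_zero (i : Fin D.t) (b : Fin D.n → ℕ) : D.xiCoeff i b ≠ 0 := by
  refine Finset.prod_ne_zero_iff.mpr fun l _ => ?_
  split_ifs
  · exact pow_ne_zero _ (D.q_ne_zero _ _)
  · exact one_ne_zero

lemma xiCoeff_add_single_of_lt {i : Fin D.t} {j : Fin D.n} (h : j < D.inc i) (b : Fin D.n → ℕ) :
    D.xiCoeff i (b + Pi.single j 1) =
      D.q (D.inc i) j ^ (D.N i * D.sigma j (b j + 1)) * D.xiCoeff i b := by
  refine Fintype.prod_eq_mul_prod_of_ne j ?_ fun l hl => by simp [hl]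
  simp [h, tau_succ, mul_add, pow_add, mul_comm (D.q (D.inc i) j ^ (D.N i * D.tau j (b j)))]

lemma xiCoeff_add_single_of_ge {i : Fin D.t} {j : Fin D.n} (h : D.inc i ≤ j) (b : Fin D.n → ℕ)
    (r : ℕ) : D.xiCoeff i (b + Pi.single j r) = D.xiCoeff i b := by
  refine Finset.prod_congr rfl fun l _ => ?_
  split_ifs with hl
  · simp [(hl.trans_le h).ne]
  · rfl

lemma dCoeff_add_single_of_lt {i j : Fin D.n} (h : i < j) (a : Fin D.n → ℕ) (r : ℕ) :
    D.dCoeff (a + Pi.single i r) j = D.dCoeff a j :=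
  D.dCoeff_congr fun l hl => by simp [(h.trans_le hl).ne']

/-- The chain map lifting `ξᵢ`. -/
def xiLift (i : Fin D.t) (m p : ℕ) : D.K p →ₗ[D.S] D.K m :=
  Finsupp.linearCombination D.S fun b : D.Index p =>
    if 2 ≤ b.tuple (D.inc i) then
      D.xiCoeff i b.tuple • D.Phi m (b.tuple - Pi.single (D.inc i) 2) else 0

lemma xiLift_Phi (i : Fin D.t) (m : ℕ) {p : ℕ} {b : Fin D.n → ℕ} (hb : D.IsIndex p b) :
    D.xiLift i m p (D.Phi p b) =
      if 2 ≤ b (D.inc i) then D.xiCoeff i b • D.Phi m (b - Pi.single (D.inc i) 2) else 0 := by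
  rw [Phi_of_isIndex D hb, xiLift, Finsupp.linearCombination_single, one_smul, hb.tuple_index]

lemma IsIndex.sub_single_two {m : ℕ} {a : Fin D.n → ℕ} (ha : D.IsIndex (m + 2) a) {i : Fin D.n}
    (hi : 2 ≤ a i) : D.IsIndex m (a - Pi.single i 2) := by
  refine ⟨fun j hj => le_trans (by simp) (ha.1 j hj), ?_⟩
  have h1 := ha.2
  rw [← sub_single_add_single hi] at h1
  simpa [Finset.sum_add_distrib] using h1

lemma K_linear_ext {m : ℕ} {M : Type*} [AddCommMonoid M] [Module D.S M]
    (f g : D.K m →ₗ[D.S] M) (h : ∀ a, D.IsIndex m a → f (D.Phi m a) = g (D.Phi m a)) : f = g := by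
  ext1 a
  ext1
  have := h a.tuple a.isIndex
  rw [Phi_index] at this
  simpa using this

variable {D} in
lemma exists_eq_add {a : Fin D.n → ℕ} {i j : Fin D.n} {r s : ℕ} (hij : i ≠ j) (hi : r ≤ a i)
    (hj : s ≤ a j) : ∃ w : Fin D.n → ℕ, a = w + Pi.single i r + Pi.single j s := by
  refine ⟨a - Pi.single j s - Pi.single i r, ?_⟩
  rw [sub_single_add_single (by simpa [hij] using hi), sub_single_add_single hj]

/-- The exponents σ_i have period two, so direction i is unaffected by lowering b_i by 2. For j < i
both coefficients change by matching powers of q_ij^{N_i}, and for j > i neither changes. -/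
theorem diff_xiLift (i : Fin D.t) (m : ℕ) (z : D.K (m + 3)) :
    D.diff m (D.xiLift i (m + 1) (m + 3) z) = D.xiLift i m (m + 2) (D.diff (m + 2) z) := by
  suffices D.diff m ∘ₗ D.xiLift i (m + 1) (m + 3) = D.xiLift i m (m + 2) ∘ₗ D.diff (m + 2) from
    LinearMap.congr_fun this z
  apply D.K_linear_ext
  intro b hb
  rw [LinearMap.comp_apply, LinearMap.comp_apply, xiLift_Phi D i _ hb, diff_Phi D hb, map_sum]
  have hterm : ∀ j, D.xiLift i m (m + 2) (if 0 < b j then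
        (D.dCoeff b j • D.x j ^ D.sigma j (b j)) • D.Phi (m + 2) (b - Pi.single j 1) else 0) =
      if 0 < b j ∧ 2 ≤ (b - Pi.single j 1 : Fin D.n → ℕ) (D.inc i) then
        (D.dCoeff b j * D.xiCoeff i (b - Pi.single j 1)) •
          (D.x j ^ D.sigma j (b j)) • D.Phi m (b - Pi.single j 1 - Pi.single (D.inc i) 2)
      else 0 := by
    intro j
    by_cases hj : 0 < b j
    · rw [if_pos hj, map_smul, xiLift_Phi D i _ (hb.sub_single hj)]
      by_cases h2 : 2 ≤ (b - Pi.single j 1 : Fin D.n → ℕ) (D.inc i)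
      · rw [if_pos h2, if_pos ⟨hj, h2⟩, smul_assoc, smul_comm (D.x j ^ _), mul_smul]
      · rw [if_neg h2, if_neg (by tauto), smul_zero]
    · rw [if_neg hj, if_neg (by tauto), map_zero]
  rw [Finset.sum_congr rfl fun j _ => hterm j]
  by_cases hi : 2 ≤ b (D.inc i)
  · rw [if_pos hi, ← algebraMap_smul D.S (D.xiCoeff i b), map_smul,
      diff_Phi D (IsIndex.sub_single_two D hb hi), Finset.smul_sum]
    refine Finset.sum_congr rfl fun j _ => ?_
    rw [algebraMap_smul]
    by_cases hji : j = D.inc i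
    · subst hji
      -- Both composites lower b_i by three in total, so smaller values give zero on both sides.
      by_cases h3 : 3 ≤ b (D.inc i)
      · rw [if_pos (by simp; omega), if_pos ⟨by omega, by simp; omega⟩, smul_assoc, smul_smul]
        obtain ⟨w, rfl⟩ : ∃ w : Fin D.n → ℕ, b = w + Pi.single (D.inc i) 3 := ⟨_, (sub_single_add_single h3).symm⟩
        have e (r s : ℕ) (hs : r + s = 3) :
            w + Pi.single (D.inc i) 3 - Pi.single (D.inc i) r = w + Pi.single (D.inc i) s := by
          rw [← hs, add_comm r, Pi.single_add, ← add_assoc, add_tsub_cancel_right]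
        have e1 : w + Pi.single (D.inc i) 2 - Pi.single (D.inc i) 2 = w :=
          add_tsub_cancel_right _ _
        have e2 : w + Pi.single (D.inc i) 1 - Pi.single (D.inc i) 1 = w :=
          add_tsub_cancel_right _ _
        rw [e 2 1 rfl, e 1 2 rfl, e1, e2]
        have es : D.sigma (D.inc i) ((w + Pi.single (D.inc i) 3 : Fin D.n → ℕ) (D.inc i)) =
            D.sigma (D.inc i) ((w + Pi.single (D.inc i) 1 : Fin D.n → ℕ) (D.inc i)) := by
          simpa using D.sigma_add_two (D.inc i) (w (D.inc i) + 1)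
        rw [es]
        congr 1
        have ed : D.dCoeff (w + Pi.single (D.inc i) 3) (D.inc i) =
            D.dCoeff (w + Pi.single (D.inc i) 1) (D.inc i) := by
          unfold dCoeff
          rw [es]
          refine Finset.prod_congr rfl fun l hl => ?_
          have hl := (Finset.mem_filter.mp hl).2
          simp [hl.ne']
        rw [ed, xiCoeff_add_single_of_ge D le_rfl, xiCoeff_add_single_of_ge D le_rfl, mul_comm]
      · rw [if_neg (by simp; omega), if_neg (by simp; omega), smul_zero]
    · by_cases hj : 0 < b j
      · rw [if_pos (by simpa [hji] using hj),
          if_pos ⟨hj, by simpa [Ne.symm hji] using hi⟩, smul_assoc, smul_smul]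
        obtain ⟨w, rfl⟩ := exists_eq_add (s := 1) (Ne.symm hji) hi hj
        have e1 : w + Pi.single (D.inc i) 2 + Pi.single j 1 - Pi.single (D.inc i) 2 =
            w + Pi.single j 1 := by rw [add_right_comm, add_tsub_cancel_right]
        have e2 : w + Pi.single (D.inc i) 2 + Pi.single j 1 - Pi.single j 1 =
            w + Pi.single (D.inc i) 2 := add_tsub_cancel_right _ _
        rw [e1, e2, add_tsub_cancel_right, add_tsub_cancel_right]
        simp only [Pi.add_apply, Pi.single_eq_of_ne hji, Pi.single_eq_same, add_zero]
        congr 1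
        rcases lt_or_gt_of_ne hji with h | h
        · rw [xiCoeff_add_single_of_lt D h, add_right_comm, dCoeff_add_single_two D h]
          simp only [Pi.add_apply, Pi.single_eq_of_ne hji, Pi.single_eq_same, add_zero]
          ring
        · rw [xiCoeff_add_single_of_ge D h.le, add_right_comm, dCoeff_add_single_of_lt D h, mul_comm]
      · rw [if_neg (by simp; omega), if_neg (by tauto), smul_zero]
  · rw [if_neg hi, map_zero, Finset.sum_eq_zero]
    intro j _
    rw [if_neg]
    rintro ⟨_, h⟩
    exact hi (h.trans (by simp))

end QuantumData

/-! ### The chain map lifting η_i -/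

namespace QuantumData

variable {k : Type u} [Field k] (D : QuantumData k)

/-- The part of the coefficients of the chain map lifting `ηᵢ` which comes from the indices on the
left of `i`. -/
def etaLeft (i : Fin D.n) (b : Fin D.n → ℕ) : k :=
  ∏ l, if l < i then D.q i l ^ D.tau l (b l) else 1

/-- The part of the coefficients of the chain map lifting `ηᵢ` which comes from the indices on the
right of `i`. -/
def etaRight (i : Fin D.n) (b : Fin D.n → ℕ) : k :=
  -- This is the coefficient of d in direction i with one power of x_i divided out, whence the
  -- exponent σ_i - 1.
  ∏ l, if i < l then (-1) ^ b l * D.q l i ^ ((D.sigma i (b i) - 1) * D.tau l (b l)) else 1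

/-- The coefficients of the chain map lifting `ηᵢ`. -/
def etaCoeff (i : Fin D.n) (b : Fin D.n → ℕ) : k :=
  (-1) ^ (b i - 1) * D.etaLeft i b * D.etaRight i b

lemma etaCoeff_ne_zero (i : Fin D.n) (b : Fin D.n → ℕ) : D.etaCoeff i b ≠ 0 := by
  have h1 : ((-1 : k)) ≠ 0 := neg_ne_zero.mpr one_ne_zero
  refine mul_ne_zero (mul_ne_zero (pow_ne_zero _ h1) ?_) ?_
  · refine Finset.prod_ne_zero_iff.mpr fun l _ => ?_
    split_ifs
    · exact pow_ne_zero _ (D.q_ne_zero _ _)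
    · exact one_ne_zero
  · refine Finset.prod_ne_zero_iff.mpr fun l _ => ?_
    split_ifs
    · exact mul_ne_zero (pow_ne_zero _ h1) (pow_ne_zero _ (D.q_ne_zero _ _))
    · exact one_ne_zero

lemma etaLeft_add_single_of_lt {i j : Fin D.n} (h : j < i) (b : Fin D.n → ℕ) :
    D.etaLeft i (b + Pi.single j 1) = D.q i j ^ D.sigma j (b j + 1) * D.etaLeft i b := by
  refine Fintype.prod_eq_mul_prod_of_ne j ?_ fun l hl => by simp [hl]
  simp [h, tau_succ, pow_add, mul_comm (D.q i j ^ D.tau j (b j))]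

lemma etaLeft_add_single_of_le {i j : Fin D.n} (h : i ≤ j) (b : Fin D.n → ℕ) (r : ℕ) :
    D.etaLeft i (b + Pi.single j r) = D.etaLeft i b := by
  refine Finset.prod_congr rfl fun l _ => ?_
  split_ifs with hl
  · simp [(hl.trans_le h).ne]
  · rfl

lemma etaRight_add_single_of_lt {i j : Fin D.n} (h : i < j) (b : Fin D.n → ℕ) :
    D.etaRight i (b + Pi.single j 1) =
      -(D.q j i ^ ((D.sigma i (b i) - 1) * D.sigma j (b j + 1))) * D.etaRight i b := by
  refine Fintype.prod_eq_mul_prod_of_ne j ?_ fun l hl => by simp [hl, h.ne]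
  simp only [h, if_true, Pi.add_apply, Pi.single_eq_same, tau_succ, Pi.single_eq_of_ne h.ne,
    add_zero, mul_add, pow_add]
  ring

lemma etaRight_add_single_of_gt {i j : Fin D.n} (h : j < i) (b : Fin D.n → ℕ) (r : ℕ) :
    D.etaRight i (b + Pi.single j r) = D.etaRight i b := by
  refine Finset.prod_congr rfl fun l _ => ?_
  split_ifs with hl
  · simp [(h.trans hl).ne', h.ne']
  · rfl

lemma etaCoeff_add_single_of_lt {i j : Fin D.n} (h : j < i) (b : Fin D.n → ℕ) :
    D.etaCoeff i (b + Pi.single j 1) = D.q i j ^ D.sigma j (b j + 1) * D.etaCoeff i b := by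
  simp only [etaCoeff, etaLeft_add_single_of_lt D h, etaRight_add_single_of_gt D h, Pi.add_apply,
    Pi.single_eq_of_ne h.ne', add_zero]
  ring

lemma etaCoeff_add_single_of_gt {i j : Fin D.n} (h : i < j) (b : Fin D.n → ℕ) :
    D.etaCoeff i (b + Pi.single j 1) =
      -(D.q j i ^ ((D.sigma i (b i) - 1) * D.sigma j (b j + 1))) * D.etaCoeff i b := by
  simp only [etaCoeff, etaLeft_add_single_of_le D h.le, etaRight_add_single_of_lt D h,
    Pi.add_apply, Pi.single_eq_of_ne h.ne, add_zero]
  ring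

/-- The compatibility of the coefficients of the lift of `ηᵢ` with the differential at `i`. -/
lemma etaCoeff_mul_dCoeff (i : Fin D.n) (w : Fin D.n → ℕ) :
    D.etaCoeff i (w + Pi.single i 2) * D.dCoeff (w + Pi.single i 1) i =
      -(D.dCoeff (w + Pi.single i 2) i * D.etaCoeff i (w + Pi.single i 1)) := by
  have key : D.etaRight i (w + Pi.single i 2) * D.dCoeff (w + Pi.single i 1) i =
      D.dCoeff (w + Pi.single i 2) i * D.etaRight i (w + Pi.single i 1) := by
    rw [dCoeff_eq, dCoeff_eq, etaRight, etaRight, ← Finset.prod_mul_distrib,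
      ← Finset.prod_mul_distrib]
    refine Finset.prod_congr rfl fun l _ => ?_
    split_ifs with hl
    · simp only [Pi.add_apply, Pi.single_eq_same, Pi.single_eq_of_ne hl.ne', add_zero]
      obtain ⟨s, hs⟩ : ∃ s, D.sigma i (w i + 1) = s + 1 :=
        ⟨_, (Nat.sub_add_cancel (D.sigma_pos i _)).symm⟩
      obtain ⟨r, hr⟩ : ∃ r, D.sigma i (w i + 2) = r + 1 :=
        ⟨_, (Nat.sub_add_cancel (D.sigma_pos i _)).symm⟩
      rw [hs, hr]
      simp only [Nat.add_sub_cancel]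
      ring
    · rfl
  simp only [etaCoeff, etaLeft_add_single_of_le D le_rfl, Pi.add_apply, Pi.single_eq_same]
  have e : w i + 2 - 1 = (w i + 1 - 1) + 1 := by omega
  rw [e, pow_succ]
  linear_combination (-(-1) ^ (w i + 1 - 1) * D.etaLeft i w) * key

/-- The chain map lifting `ηᵢ`. -/
def etaLift (i : Fin D.n) (m p : ℕ) : D.K p →ₗ[D.S] D.K m :=
  Finsupp.linearCombination D.S fun b : D.Index p =>
    if 1 ≤ b.tuple i then
      (D.etaCoeff i b.tuple • D.x i ^ (D.sigma i (b.tuple i) - 1)) •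
        D.Phi m (b.tuple - Pi.single i 1) else 0

lemma etaLift_Phi (i : Fin D.n) (m : ℕ) {p : ℕ} {b : Fin D.n → ℕ} (hb : D.IsIndex p b) :
    D.etaLift i m p (D.Phi p b) =
      if 1 ≤ b i then (D.etaCoeff i b • D.x i ^ (D.sigma i (b i) - 1)) •
        D.Phi m (b - Pi.single i 1) else 0 := by
  rw [Phi_of_isIndex D hb, etaLift, Finsupp.linearCombination_single, one_smul, hb.tuple_index]

/-- The lift is the i-th part of d with one x_i divided out, so anticommutation in direction i
compares equal total exponents with opposite signs. For j ≠ i, moving x_j past x_i^{σ_i-1} costs a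
power of q_ij that the coefficients compensate. -/
theorem diff_etaLift (i : Fin D.n) (m : ℕ) (z : D.K (m + 2)) :
    D.diff m (D.etaLift i (m + 1) (m + 2) z) =
      (-1 : k) • D.etaLift i m (m + 1) (D.diff (m + 1) z) := by
  suffices D.diff m ∘ₗ D.etaLift i (m + 1) (m + 2) =
      (-1 : k) • (D.etaLift i m (m + 1) ∘ₗ D.diff (m + 1)) from LinearMap.congr_fun this z
  apply D.K_linear_ext
  intro b hb
  rw [LinearMap.smul_apply, LinearMap.comp_apply, LinearMap.comp_apply, etaLift_Phi D i _ hb,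
    diff_Phi D hb, map_sum]
  have hterm : ∀ j, D.etaLift i m (m + 1) (if 0 < b j then
        (D.dCoeff b j • D.x j ^ D.sigma j (b j)) • D.Phi (m + 1) (b - Pi.single j 1) else 0) =
      if 0 < b j ∧ 1 ≤ (b - Pi.single j 1 : Fin D.n → ℕ) i then
        ((D.dCoeff b j * D.etaCoeff i (b - Pi.single j 1)) •
          (D.x j ^ D.sigma j (b j) *
            D.x i ^ (D.sigma i ((b - Pi.single j 1 : Fin D.n → ℕ) i) - 1))) •
              D.Phi m (b - Pi.single j 1 - Pi.single i 1)
      else 0 := by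
    intro j
    by_cases hj : 0 < b j
    · rw [if_pos hj, map_smul, etaLift_Phi D i _ (hb.sub_single hj)]
      by_cases h2 : 1 ≤ (b - Pi.single j 1 : Fin D.n → ℕ) i
      · rw [if_pos h2, if_pos ⟨hj, h2⟩, smul_smul, smul_mul_smul_comm]
      · rw [if_neg h2, if_neg (by tauto), smul_zero]
    · rw [if_neg hj, if_neg (by tauto), map_zero]
  rw [Finset.sum_congr rfl fun j _ => hterm j]
  by_cases hi : 1 ≤ b i
  · rw [if_pos hi, map_smul, diff_Phi D (hb.sub_single hi), Finset.smul_sum,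
      Finset.smul_sum]
    refine Finset.sum_congr rfl fun j _ => ?_
    by_cases hji : j = i
    · subst hji
      by_cases h3 : 2 ≤ b j
      · rw [if_pos (by simp; omega), if_pos ⟨by omega, by simp; omega⟩, smul_smul,
          smul_mul_smul_comm]
        obtain ⟨w, rfl⟩ : ∃ w : Fin D.n → ℕ, b = w + Pi.single j 2 :=
          ⟨_, (sub_single_add_single h3).symm⟩
        have e1 : w + Pi.single j 2 - Pi.single j 1 = w + Pi.single j 1 := by
          rw [show (2 : ℕ) = 1 + 1 from rfl, Pi.single_add, ← add_assoc, add_tsub_cancel_right]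
        rw [e1, add_tsub_cancel_right, etaCoeff_mul_dCoeff, ← smul_assoc, smul_smul, neg_one_mul]
        congr 2
        simp only [Pi.add_apply, Pi.single_eq_same]
        -- Since both σ values are positive, the missing x_i may be taken from either factor.
        rw [← pow_add, ← pow_add]
        have h1 := D.sigma_pos j (w j + 1)
        have h2 := D.sigma_pos j (w j + 2)
        congr 1
        omega
      · rw [if_neg (by simp; omega), if_neg (by simp; omega), smul_zero, smul_zero]
    · by_cases hj : 0 < b j
      · rw [if_pos (by simpa [hji] using hj),
          if_pos ⟨hj, by simpa [Ne.symm hji] using hi⟩, smul_smul, smul_mul_smul_comm]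
        obtain ⟨w, rfl⟩ := exists_eq_add (r := 1) (s := 1) (Ne.symm hji) hi hj
        have e1 : w + Pi.single i 1 + Pi.single j 1 - Pi.single i 1 =
            w + Pi.single j 1 := by rw [add_right_comm, add_tsub_cancel_right]
        have e2 : w + Pi.single i 1 + Pi.single j 1 - Pi.single j 1 =
            w + Pi.single i 1 := add_tsub_cancel_right _ _
        rw [e1, e2, add_tsub_cancel_right, add_tsub_cancel_right]
        simp only [Pi.add_apply, Pi.single_eq_of_ne hji, Pi.single_eq_of_ne (Ne.symm hji),
          Pi.single_eq_same, add_zero]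
        rw [x_pow_mul_x_pow, smul_smul, ← smul_assoc, smul_smul]
        congr 2
        obtain ⟨s, hs⟩ : ∃ s, D.sigma i (w i + 1) = s + 1 :=
          ⟨_, (Nat.sub_add_cancel (D.sigma_pos i _)).symm⟩
        rcases lt_or_gt_of_ne hji with h | h
        · rw [etaCoeff_add_single_of_lt D h, add_right_comm, dCoeff_add_single D h]
          simp only [Pi.add_apply, Pi.single_eq_of_ne hji, Pi.single_eq_of_ne (Ne.symm hji),
            Pi.single_eq_same, add_zero, hs, Nat.add_sub_cancel]
          ring
        · rw [etaCoeff_add_single_of_gt D h, add_right_comm, dCoeff_add_single_of_lt D h]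
          simp only [Pi.add_apply, Pi.single_eq_of_ne hji, Pi.single_eq_same, add_zero, hs,
            Nat.add_sub_cancel]
          have hq : D.q j i ^ (s * D.sigma j (w j + 1)) * D.q i j ^ (s * D.sigma j (w j + 1)) =
              1 := by rw [← mul_pow, D.q_mul_q, one_pow]
          linear_combination
            (-(D.etaCoeff i (w + Pi.single i 1) * D.dCoeff (w + Pi.single j 1) j)) * hq
      · rw [if_neg (by simp; omega), if_neg (by tauto), smul_zero, smul_zero]
  · rw [if_neg hi, map_zero, Finset.sum_eq_zero, smul_zero]
    intro j _
    rw [if_neg]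
    rintro ⟨_, h⟩
    exact hi (h.trans (by simp))

end QuantumData

/-! ### Extension classes -/

namespace QuantumData

variable {k : Type u} [Field k] (D : QuantumData k)

/-- A scalar as an element of the trivial module. -/
def ofField (c : k) : D.trivialModule := c

@[simp] lemma toField_ofField (c : k) : D.toField (D.ofField c) = c := rfl

lemma toField_zero : D.toField 0 = 0 := rfl

lemma toField_add (m m' : D.trivialModule) : D.toField (m + m') = D.toField m + D.toField m' := rfl

lemma toField_algebraMap_smul (c : k) (m : D.trivialModule) :
    D.toField (algebraMap k D.S c • m) = c * D.toField m := by
  rw [toField_smul, AlgHom.commutes]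
  rfl

/-- The linear map `K_m → k` with prescribed values on the generators. -/
def functional {m : ℕ} (f : D.Index m → k) : D.K m →ₗ[D.S] D.trivialModule :=
  Finsupp.linearCombination D.S fun b => D.ofField (f b)

lemma toField_functional_single {m : ℕ} (f : D.Index m → k) (b : D.Index m) (s : D.S) :
    D.toField (D.functional f (Finsupp.single b s)) = D.aug s * f b := by
  rw [functional, Finsupp.linearCombination_single, toField_smul]
  rfl

lemma eq_functional {m : ℕ} {g : D.K m →ₗ[D.S] D.trivialModule} {f : D.Index m → k}
    (h : ∀ b, D.toField (g (Finsupp.single b 1)) = f b) : g = D.functional f := by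
  ext1 b
  ext1
  apply D.toField_injective
  rw [LinearMap.comp_apply, LinearMap.comp_apply, Finsupp.lsingle_apply, h,
    toField_functional_single, map_one, one_mul]

/-- A linear map `K_m → k` as a morphism from the resolution. -/
def cochain {m : ℕ} (g : D.K m →ₗ[D.S] D.trivialModule) :
    D.resolution.complex.X m ⟶ D.trivialModule :=
  ModuleCat.ofHom (R := D.S) (X := D.K m) (Y := D.trivialModule) g

lemma cochain_ext {m : ℕ} {g g' : D.resolution.complex.X m ⟶ D.trivialModule}
    (h : ∀ z : D.K m, g.hom z = g'.hom z) : g = g' := by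
  ext1
  exact LinearMap.ext h

/-- Minimality of the resolution: every cochain with values in k is a cocycle. -/
lemma d_cochain {m : ℕ} (g : D.resolution.complex.X m ⟶ D.trivialModule) :
    D.resolution.complex.d (m + 1) m ≫ g = 0 := by
  apply D.cochain_ext
  intro z
  exact (congrArg g.hom (D.complex_d_hom_apply m z)).trans (D.apply_diff_eq_zero g.hom z)

/-- The extension class of the linear map `K_m → k` with prescribed values on the generators. -/
def extOf (m : ℕ) (f : D.Index m → k) : ExtAlgebra.Comp D.trivialModule m :=
  D.resolution.extMk (D.cochain (D.functional f)) (m + 1) rfl (D.d_cochain _)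

lemma extOf_add {m : ℕ} (f g : D.Index m → k) :
    D.extOf m (f + g) = D.extOf m f + D.extOf m g := by
  rw [extOf, extOf, extOf, ProjectiveResolution.add_extMk]
  congr 1
  apply D.cochain_ext
  intro z
  change D.functional (f + g) z = (D.functional f + D.functional g) z
  congr 1
  symm
  apply D.eq_functional
  intro b
  rw [LinearMap.add_apply, toField_add, toField_functional_single, toField_functional_single]
  simp

lemma extOf_smul {m : ℕ} (c : k) (f : D.Index m → k) :
    D.extOf m (c • f) = c • D.extOf m f := by
  rw [Abelian.Ext.smul_eq_comp_mk₀, extOf, extOf, ProjectiveResolution.extMk_comp_mk₀]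
  congr 1
  apply D.cochain_ext
  intro z
  change D.functional (c • f) z = algebraMap k D.S c • D.functional f z
  induction z using Finsupp.induction_linear with
  | zero => rw [map_zero, map_zero, smul_zero]
  | add z w hz hw => rw [map_add, map_add, smul_add, hz, hw]
  | single b s =>
    apply D.toField_injective
    rw [toField_algebraMap_smul, toField_functional_single, toField_functional_single,
      Pi.smul_apply, smul_eq_mul, mul_left_comm]

/-- The map sending a function on the generators of `K_m` to its class in `Ext^m(k, k)`. -/
def extLinear (m : ℕ) : (D.Index m → k) →ₗ[k] ExtAlgebra.Comp D.trivialModule m where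
  toFun := D.extOf m
  map_add' f g := D.extOf_add f g
  map_smul' c f := D.extOf_smul c f

lemma extOf_surjective (m : ℕ) : Function.Surjective (D.extOf m) := by
  intro α
  obtain ⟨g, hg, rfl⟩ := D.resolution.extMk_surjective α (m + 1) rfl
  refine ⟨fun b => D.toField (g.hom (Finsupp.single b 1 : D.K m)), ?_⟩
  rw [extOf]
  congr 1
  apply D.cochain_ext
  intro z
  exact (LinearMap.congr_fun (D.eq_functional (g := g.hom) fun b => rfl) z).symm

lemma extOf_zero_one : D.extOf 0 (fun _ => 1) = Abelian.Ext.mk₀ (𝟙 D.trivialModule) := by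
  rw [← D.resolution.extMk_π, extOf]
  congr 1

/-- In positive degree a null class factors through d, and such maps to k vanish by minimality.
Degree 0 has no coboundaries and is identified with Hom(k,k). -/
lemma extOf_eq_zero {m : ℕ} {f : D.Index m → k} (h : D.extOf m f = 0) : f = 0 := by
  cases m with
  | zero =>
    have h0 : f = f D.isIndex_zero.index • fun _ => 1 := by
      ext b
      have : b = D.isIndex_zero.index := Subtype.ext (IsIndex.eq_zero D b.isIndex)
      rw [this, Pi.smul_apply, smul_eq_mul, mul_one]
    rw [h0, extOf_smul, extOf_zero_one] at h
    have h1 : f D.isIndex_zero.index • 𝟙 D.trivialModule = 0 := by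
      rw [← (Abelian.Ext.linearEquiv₀ (R := k)).symm.map_eq_zero_iff, map_smul]
      exact h
    have h2 : D.toField (algebraMap k D.S (f D.isIndex_zero.index) • D.ofField 1) = 0 :=
      congrArg (fun g : D.trivialModule ⟶ D.trivialModule => D.toField (g.hom (D.ofField 1))) h1
    rw [toField_algebraMap_smul, toField_ofField, mul_one] at h2
    rw [h0, h2, zero_smul]
  | succ m =>
    obtain ⟨g, hg⟩ := (D.resolution.extMk_eq_zero_iff _ _ _ _ m rfl).mp h
    ext b
    have h1 : D.toField (D.functional f (Finsupp.single b 1)) = f b := by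
      rw [toField_functional_single, map_one, one_mul]
    rw [← h1]
    have h2 : D.cochain (D.functional f) = 0 := hg.symm.trans (D.d_cochain g)
    exact congrArg (fun g : D.resolution.complex.X (m + 1) ⟶ D.trivialModule =>
      D.toField (g.hom (Finsupp.single b 1 : D.K (m + 1)))) h2

lemma extLinear_bijective (m : ℕ) : Function.Bijective (D.extLinear m) :=
  ⟨(injective_iff_map_eq_zero _).mpr fun _ h => D.extOf_eq_zero h, D.extOf_surjective m⟩

lemma neg_one_smul_K {m : ℕ} (z : D.K m) : (-1 : k) • z = -z := by
  ext1 b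
  exact neg_one_smul k (z b)

/-- The product of two extension classes, computed with a chain map lifting the second one. -/
theorem gmul_extOf {n m : ℕ} (L : ∀ m p, D.K p →ₗ[D.S] D.K m) (f : D.Index n → k)
    (hL : ∀ m p (z : D.K (p + 1)), m + n = p →
      D.diff m (L (m + 1) (p + 1) z) = (-1 : k) ^ n • L m p (D.diff p z))
    (hL₀ : ∀ b, D.toField (D.augK (L 0 n (Finsupp.single b 1))) = f b)
    (g : D.Index m → k) (h : D.Index (m + n) → k)
    (hg : ∀ b, D.toField (D.functional g (L m (m + n) (Finsupp.single b 1))) = h b) :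
    (GradedMonoid.GMul.mul (D.extOf m g) (D.extOf n f) :
      ExtAlgebra.Comp D.trivialModule (m + n)) = D.extOf (m + n) h := by
  rw [ExtAlgebra.gmul_def, extOf, extOf, extOf]
  refine (D.resolution.extMk_comp_extMk (r := m + n) _ _ rfl (D.d_cochain _)
    (fun m p _ => ModuleCat.ofHom (R := D.S) (X := D.K p) (Y := D.K m) (L m p)) ?_ ?_ _ _ rfl
    (D.d_cochain _) (add_comm n m) _ rfl (D.d_cochain _)).trans ?_
  · intro m p hp
    rw [show D.resolution.complex.d (m + 1) m = _ from D.complex_d m,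
      show D.resolution.complex.d (p + 1) p = _ from D.complex_d p]
    rcases Nat.even_or_odd n with hn | hn
    · ext1
      refine LinearMap.ext fun z => ?_
      have := hL m p z hp
      rw [hn.neg_one_pow, one_smul] at this
      rw [hn.neg_one_pow, one_smul]
      exact this
    · ext1
      refine LinearMap.ext fun z => ?_
      have := hL m p z hp
      rw [hn.neg_one_pow] at this
      rw [hn.neg_one_pow, neg_one_smul]
      exact this.trans (D.neg_one_smul_K _)
  · rw [resolution_π_f_zero]
    apply D.cochain_ext
    intro z
    exact LinearMap.congr_fun (D.eq_functional (g := D.augK ∘ₗ L 0 n) hL₀) z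
  · congr 1
    apply D.cochain_ext
    intro z
    exact LinearMap.congr_fun (D.eq_functional (g := D.functional g ∘ₗ L m (m + n)) hg) z

lemma toField_functional_smul_Phi {m : ℕ} (G : (Fin D.n → ℕ) → k) (s : D.S) {a : Fin D.n → ℕ}
    (ha : D.IsIndex m a) :
    D.toField (D.functional (fun b : D.Index m => G b.tuple) (s • D.Phi m a)) = D.aug s * G a := by
  rw [Phi_of_isIndex D ha, Finsupp.smul_single, smul_eq_mul, mul_one, toField_functional_single,
    ha.tuple_index]

lemma toField_functional_xiLift (j : Fin D.t) (m : ℕ) (G : (Fin D.n → ℕ) → k) (b : D.Index (m + 2)) :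
    D.toField (D.functional (fun b : D.Index m => G b.tuple)
      (D.xiLift j m (m + 2) (Finsupp.single b 1))) =
      if 2 ≤ b.tuple (D.inc j) then
        D.xiCoeff j b.tuple * G (b.tuple - Pi.single (D.inc j) 2) else 0 := by
  rw [← Phi_index, xiLift_Phi D j _ b.isIndex]
  split_ifs with h
  · rw [← algebraMap_smul D.S, toField_functional_smul_Phi D G _ (IsIndex.sub_single_two D b.isIndex h),
      AlgHom.commutes]
    rfl
  · rw [map_zero, toField_zero]

/-- The factor x_i^{σ_i-1} acts on k as 1 if σ_i = 1 and as 0 otherwise; this is the source of the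
vanishing in η_i². -/
lemma toField_functional_etaLift (i : Fin D.n) (m : ℕ) (G : (Fin D.n → ℕ) → k)
    (b : D.Index (m + 1)) :
    D.toField (D.functional (fun b : D.Index m => G b.tuple)
      (D.etaLift i m (m + 1) (Finsupp.single b 1))) =
      if 1 ≤ b.tuple i then
        D.etaCoeff i b.tuple * (if D.sigma i (b.tuple i) = 1 then 1 else 0) *
          G (b.tuple - Pi.single i 1) else 0 := by
  rw [← Phi_index, etaLift_Phi D i _ b.isIndex]
  split_ifs with h h1
  · rw [toField_functional_smul_Phi D G _ (b.isIndex.sub_single h), h1, map_smul]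
    simp
  · have := D.sigma_pos i (b.tuple i)
    rw [toField_functional_smul_Phi D G _ (b.isIndex.sub_single h), map_smul, map_pow, aug_x,
      zero_pow (by omega)]
    simp
  · rw [map_zero, toField_zero]

/-- The extension class dual to the generator `Φ(a)` of `K_m`. -/
def cls (m : ℕ) (a : Fin D.n → ℕ) : ExtAlgebra.Comp D.trivialModule m :=
  D.extOf m fun b => if b.tuple = a then 1 else 0

lemma cls_eq_zero {m : ℕ} {a : Fin D.n → ℕ} (h : ¬ D.IsIndex m a) : D.cls m a = 0 := by
  refine Eq.trans ?_ (D.extLinear m).map_zero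
  change D.extOf m _ = D.extOf m _
  congr 1
  ext b
  rw [if_neg]
  · rfl
  · rintro rfl
    exact h b.isIndex

lemma isDualClass_cls (m : ℕ) (a : Fin D.n → ℕ) :
    D.twistedResolution.IsDualClass a (D.cls m a) := by
  refine ⟨D.cochain (D.functional fun b : D.Index m => if b.tuple = a then 1 else 0),
    D.d_cochain _, fun b => ?_, rfl⟩
  exact (D.toField_functional_single _ b 1).trans (by rw [map_one, one_mul]; rfl)

lemma cls_zero : D.cls 0 0 = Abelian.Ext.mk₀ (𝟙 D.trivialModule) := by
  rw [← extOf_zero_one, cls]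
  congr 1
  ext b
  exact if_pos (IsIndex.eq_zero D b.isIndex)

lemma eq_add_single_iff {ι : Type*} [DecidableEq ι] {a b : ι → ℕ} {i : ι} {r : ℕ} :
    b = a + Pi.single i r ↔ r ≤ b i ∧ b - Pi.single i r = a := by
  constructor
  · rintro rfl
    simp
  · rintro ⟨h, rfl⟩
    exact (sub_single_add_single h).symm

/-- In a product the right factor acts first, so `xiLift` is composed with the dual function of
Φ(a), which picks out the single generator Φ(a+2e_j). -/
theorem cls_gmul_xi (j : Fin D.t) (m : ℕ) (a : Fin D.n → ℕ) :
    (GradedMonoid.GMul.mul (D.cls m a) (D.cls 2 (Pi.single (D.inc j) 2)) :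
      ExtAlgebra.Comp D.trivialModule (m + 2)) =
      D.xiCoeff j (a + Pi.single (D.inc j) 2) • D.cls (m + 2) (a + Pi.single (D.inc j) 2) := by
  rw [cls, cls, cls, ← extOf_smul]
  refine D.gmul_extOf (D.xiLift j) _ ?_ ?_ _ _ ?_
  · rintro m p z rfl
    rw [neg_one_sq, one_smul]
    exact D.diff_xiLift j m z
  · intro b
    refine (D.toField_functional_xiLift j 0 (fun _ => 1) b).trans ?_
    have h0 : b.tuple = Pi.single (D.inc j) 2 ↔ 2 ≤ b.tuple (D.inc j) := by
      rw [← zero_add (Pi.single (D.inc j) 2 : Fin D.n → ℕ), eq_add_single_iff]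
      exact and_iff_left_of_imp fun h => IsIndex.eq_zero D (IsIndex.sub_single_two D b.isIndex h)
    by_cases h : 2 ≤ b.tuple (D.inc j)
    · rw [if_pos h, if_pos (h0.mpr h), h0.mpr h, mul_one, xiCoeff]
      refine Finset.prod_eq_one fun l _ => ?_
      split_ifs with hl
      · simp [hl.ne, tau_zero]
      · rfl
    · rw [if_neg h, if_neg (fun hc => h (h0.mp hc))]
  · intro b
    refine (D.toField_functional_xiLift j m (fun c => if c = a then 1 else 0) b).trans ?_
    by_cases h : b.tuple = a + Pi.single (D.inc j) 2
    · obtain ⟨h1, h2⟩ := eq_add_single_iff.mp h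
      rw [if_pos h1, if_pos h2, Pi.smul_apply, if_pos h, h]
      rfl
    · rw [Pi.smul_apply, if_neg h, smul_zero, ite_eq_right_iff]
      intro h1
      rw [if_neg fun h2 => h (eq_add_single_iff.mpr ⟨h1, h2⟩), mul_zero]

theorem cls_gmul_eta (i : Fin D.n) (m : ℕ) (a : Fin D.n → ℕ) :
    (GradedMonoid.GMul.mul (D.cls m a) (D.cls 1 (Pi.single i 1)) :
      ExtAlgebra.Comp D.trivialModule (m + 1)) =
      (D.etaCoeff i (a + Pi.single i 1) * if D.sigma i (a i + 1) = 1 then 1 else 0) •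
        D.cls (m + 1) (a + Pi.single i 1) := by
  rw [cls, cls, cls, ← extOf_smul]
  refine D.gmul_extOf (D.etaLift i) _ ?_ ?_ _ _ ?_
  · rintro m p z rfl
    rw [pow_one]
    exact D.diff_etaLift i m z
  · intro b
    refine (D.toField_functional_etaLift i 0 (fun _ => 1) b).trans ?_
    have h0 : b.tuple = Pi.single i 1 ↔ 1 ≤ b.tuple i := by
      rw [← zero_add (Pi.single i 1 : Fin D.n → ℕ), eq_add_single_iff]
      exact and_iff_left_of_imp fun h => IsIndex.eq_zero D (b.isIndex.sub_single h)
    by_cases h : 1 ≤ b.tuple i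
    · rw [if_pos h, if_pos (h0.mpr h), h0.mpr h, mul_one, Pi.single_eq_same,
        if_pos (D.sigma_of_odd i odd_one), mul_one, etaCoeff, etaLeft, etaRight,
        Finset.prod_eq_one, Finset.prod_eq_one, Pi.single_eq_same]
      · simp
      · intro l _
        split_ifs with hl
        · simp [hl.ne', tau_zero]
        · rfl
      · intro l _
        split_ifs with hl
        · simp [hl.ne, tau_zero]
        · rfl
    · rw [if_neg h, if_neg (fun hc => h (h0.mp hc))]
  · intro b
    refine (D.toField_functional_etaLift i m (fun c => if c = a then 1 else 0) b).trans ?_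
    by_cases h : b.tuple = a + Pi.single i 1
    · obtain ⟨h1, h2⟩ := eq_add_single_iff.mp h
      rw [if_pos h1, if_pos h2, Pi.smul_apply, if_pos h, h, Pi.add_apply, Pi.single_eq_same]
      rfl
    · rw [Pi.smul_apply, if_neg h, smul_zero, ite_eq_right_iff]
      intro h1
      rw [if_neg fun h2 => h (eq_add_single_iff.mpr ⟨h1, h2⟩), mul_zero]

end QuantumData

/-! ### The cohomology algebra -/

namespace QuantumData

variable {k : Type u} [Field k] (D : QuantumData k)

lemma homog_smul (r : ℕ) (c : k) (α : ExtAlgebra.Comp D.trivialModule r) :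
    D.homog r (c • α) = c • D.homog r α :=
  (DirectSum.lof k ℕ (ExtAlgebra.Comp D.trivialModule) r).map_smul c α

lemma homog_mul_homog (r s : ℕ) (α : ExtAlgebra.Comp D.trivialModule r)
    (β : ExtAlgebra.Comp D.trivialModule s) :
    D.homog r α * D.homog s β = D.homog (r + s) (GradedMonoid.GMul.mul α β) :=
  DirectSum.of_mul_of _ _

/-- The class in the cohomology algebra dual to the generator `Φ(a)`. -/
def H (a : Fin D.n → ℕ) : D.Cohomology := D.homog (∑ i, a i) (D.cls _ a)

lemma homog_cls {m : ℕ} {a : Fin D.n → ℕ} (h : ∑ i, a i = m) : D.homog m (D.cls m a) = D.H a := by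
  subst h
  rfl

lemma H_eq_zero {a : Fin D.n → ℕ} {i : Fin D.n} (h : D.t ≤ (i : ℕ)) (hi : 1 < a i) :
    D.H a = 0 := by
  rw [H, cls_eq_zero]
  · exact map_zero _
  · exact fun hc => (hc.1 i h).not_gt hi

lemma H_zero : D.H 0 = 1 := by
  rw [← D.homog_cls (m := 0) (by simp), cls_zero]
  rfl

/-- The class `ξ_j`. -/
def xi (j : Fin D.t) : D.Cohomology := D.homog 2 (D.cls 2 (Pi.single (D.inc j) 2))

/-- The class `η_i`. -/
def eta (i : Fin D.n) : D.Cohomology := D.homog 1 (D.cls 1 (Pi.single i 1))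

lemma xi_eq_H (j : Fin D.t) : D.xi j = D.H (Pi.single (D.inc j) 2) := D.homog_cls (by simp)

lemma eta_eq_H (i : Fin D.n) : D.eta i = D.H (Pi.single i 1) := D.homog_cls (by simp)

lemma H_mul_xi (a : Fin D.n → ℕ) (j : Fin D.t) :
    D.H a * D.xi j = D.xiCoeff j (a + Pi.single (D.inc j) 2) •
      D.H (a + Pi.single (D.inc j) 2) := by
  rw [H, xi, homog_mul_homog, cls_gmul_xi, homog_smul, homog_cls]
  simp [Finset.sum_add_distrib]

lemma H_mul_eta (a : Fin D.n → ℕ) (i : Fin D.n) :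
    D.H a * D.eta i =
      (D.etaCoeff i (a + Pi.single i 1) * if D.sigma i (a i + 1) = 1 then 1 else 0) •
        D.H (a + Pi.single i 1) := by
  rw [H, eta, homog_mul_homog, cls_gmul_eta, homog_smul, homog_cls]
  simp [Finset.sum_add_distrib]

lemma H_mul_eta_of_even {a : Fin D.n → ℕ} {i : Fin D.n} (h : Even (a i)) :
    D.H a * D.eta i = D.etaCoeff i (a + Pi.single i 1) • D.H (a + Pi.single i 1) := by
  rw [H_mul_eta, if_pos (D.sigma_of_odd i h.add_one), mul_one]

lemma tau_one (i : Fin D.n) : D.tau i 1 = 1 := by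
  rw [tau, Finset.Icc_self, Finset.sum_singleton, D.sigma_of_odd i odd_one]

lemma tau_inc_two (j : Fin D.t) : D.tau (D.inc j) 2 = D.N j := by
  rw [tau_succ, tau_succ, tau_zero, zero_add, zero_add, sigma_add_sigma]

lemma xiCoeff_single (j : Fin D.t) (i : Fin D.n) (r : ℕ) :
    D.xiCoeff j (Pi.single i r + Pi.single (D.inc j) 2) =
      if i < D.inc j then D.q (D.inc j) i ^ (D.N j * D.tau i r) else 1 := by
  rw [xiCoeff, Finset.prod_eq_single i]
  · split_ifs with h
    · simp [h.ne]
    · rfl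
  · intro l _ hl
    split_ifs with h
    · simp [hl, h.ne, tau_zero]
    · rfl
  · simp

lemma etaCoeff_single_self (i : Fin D.n) (r : ℕ) :
    D.etaCoeff i (Pi.single i r + Pi.single i 1) = (-1) ^ r := by
  rw [etaCoeff, etaLeft, etaRight, Finset.prod_eq_one, Finset.prod_eq_one]
  · simp
  · intro l _
    split_ifs with h
    · simp [h.ne', tau_zero]
    · rfl
  · intro l _
    split_ifs with h
    · simp [h.ne, tau_zero]
    · rfl

lemma etaCoeff_single_of_lt {i j : Fin D.n} (h : j < i) (r : ℕ) :
    D.etaCoeff i (Pi.single j r + Pi.single i 1) = D.q i j ^ D.tau j r := by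
  rw [etaCoeff, etaLeft, etaRight, Finset.prod_eq_single j, Finset.prod_eq_one]
  · simp [h, h.ne, h.ne']
  · intro l _
    split_ifs with hl
    · simp [hl.ne', (h.trans hl).ne', tau_zero]
    · rfl
  · intro l _ hlj
    split_ifs with hl
    · simp [hl.ne, hlj, tau_zero]
    · rfl
  · simp

lemma etaCoeff_single_of_gt {i j : Fin D.n} (h : i < j) (r : ℕ) :
    D.etaCoeff i (Pi.single j r + Pi.single i 1) = (-1) ^ r := by
  rw [etaCoeff, etaLeft, etaRight, Finset.prod_eq_one, Finset.prod_eq_single j]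
  · simp [h, h.ne, h.ne', D.sigma_of_odd i odd_one]
  · intro l _ hlj
    split_ifs with hl
    · simp [hl.ne', hlj, tau_zero]
    · rfl
  · simp
  · intro l _
    split_ifs with hl
    · simp [hl.ne, (hl.trans h).ne, tau_zero]
    · rfl

/-- Both orders give multiples of the class dual to Φ(2e_i+2e_j); only the order whose right factor
has the larger index carries a power of q. -/
theorem xi_mul_xi (i j : Fin D.t) :
    D.xi i * D.xi j = D.q (D.inc j) (D.inc i) ^ (D.N i * D.N j) • (D.xi j * D.xi i) := by
  rcases eq_or_ne i j with rfl | hij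
  · rw [D.q_self, one_pow, one_smul]
  rw [D.xi_eq_H i, H_mul_xi, ← D.xi_eq_H i, D.xi_eq_H j, H_mul_xi, smul_smul, xiCoeff_single,
    xiCoeff_single, add_comm (Pi.single (D.inc i) 2), tau_inc_two, tau_inc_two]
  congr 1
  rcases lt_or_gt_of_ne (D.inc_injective.ne hij) with h | h
  · rw [if_pos h, if_neg h.not_gt, mul_one, mul_comm (D.N j)]
  · rw [if_pos h, if_neg h.not_gt, ← mul_pow, D.q_mul_q, one_pow]

theorem eta_mul_xi (i : Fin D.n) (j : Fin D.t) :
    D.eta i * D.xi j = D.q (D.inc j) i ^ D.N j • (D.xi j * D.eta i) := by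
  have he : Even ((Pi.single (D.inc j) 2 : Fin D.n → ℕ) i) := by
    by_cases h : i = D.inc j <;> simp [h]
  rw [eta_eq_H, H_mul_xi, ← eta_eq_H, xi_eq_H, H_mul_eta_of_even D he, smul_smul, xiCoeff_single,
    add_comm (Pi.single i 1), tau_one, mul_one]
  congr 1
  rcases lt_trichotomy i (D.inc j) with h | h | h
  · rw [if_pos h, etaCoeff_single_of_gt D h]
    simp
  · rw [← h, if_neg (lt_irrefl _), etaCoeff_single_self, D.q_self]
    simp
  · rw [if_neg h.not_gt, etaCoeff_single_of_lt D h, tau_inc_two, ← mul_pow, D.q_mul_q, one_pow]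

theorem eta_mul_eta {i j : Fin D.n} (hij : i ≠ j) :
    D.eta i * D.eta j = -D.q j i • (D.eta j * D.eta i) := by
  rw [D.eta_eq_H i, H_mul_eta_of_even D (by simp [hij.symm]), ← D.eta_eq_H i, D.eta_eq_H j,
    H_mul_eta_of_even D (by simp [hij]), smul_smul, add_comm (Pi.single i 1)]
  congr 1
  rw [add_comm (Pi.single j 1)]
  rcases lt_or_gt_of_ne hij with h | h
  · rw [etaCoeff_single_of_lt D h, add_comm (Pi.single i 1), etaCoeff_single_of_gt D h, tau_one]
    simp
  · rw [etaCoeff_single_of_gt D h, add_comm (Pi.single i 1), etaCoeff_single_of_lt D h, tau_one,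
      pow_one, pow_one, neg_mul, D.q_mul_q]

/-- The minus sign is the factor (-1)^{b_i-1} of `etaCoeff` at b_i = 2. -/
lemma eta_sq (i : Fin D.n) :
    D.eta i ^ 2 = (-(if D.sigma i 2 = 1 then 1 else 0 : k)) • D.H (Pi.single i 2) := by
  rw [sq]
  nth_rw 1 [eta_eq_H]
  rw [H_mul_eta, etaCoeff_single_self, Pi.single_eq_same,
    ← Pi.single_add, pow_one, neg_one_mul]

/-- For i ≤ t the scalar vanishes since σ_i(2) = N_i - 1 ≠ 1; for i > t there is no generator
Φ(2e_i). -/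
theorem eta_sq_eq_zero {i : Fin D.n} (h : ∀ j, D.inc j = i → D.N j ≠ 2) : D.eta i ^ 2 = 0 := by
  rw [eta_sq]
  by_cases hi : (i : ℕ) < D.t
  · have h1 := h ⟨i, hi⟩ rfl
    rw [if_neg, neg_zero, zero_smul]
    rw [← D.inc_mk hi, sigma_inc, if_neg (by decide)]
    omega
  · rw [D.H_eq_zero (not_lt.mp hi) (by simp), smul_zero]

theorem eta_sq_eq {j : Fin D.t} (h : D.N j = 2) : D.eta (D.inc j) ^ 2 = (-1 : k) • D.xi j := by
  rw [eta_sq, if_pos, xi_eq_H]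
  rw [sigma_inc, if_neg (by decide), h]

end QuantumData

/-! ### The basis of ordered monomials -/

lemma DFinsupp.basis_apply {ι R : Type*} [DecidableEq ι] [Semiring R] {M : ι → Type*}
    [∀ i, AddCommMonoid (M i)] [∀ i, Module R (M i)] {η : ι → Type*}
    (b : ∀ i, Module.Basis (η i) R (M i)) (x : Σ i, η i) :
    DFinsupp.basis b x = DFinsupp.single x.1 (b x.1 x.2) := by
  classical
  apply (DFinsupp.basis b).repr.injective
  rw [Module.Basis.repr_self]
  symm
  change (sigmaFinsuppLequivDFinsupp R).symm
    (DFinsupp.mapRange.linearEquiv (fun i => (b i).repr) _) = _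
  rw [LinearEquiv.symm_apply_eq, DFinsupp.mapRange.linearEquiv_apply, DFinsupp.mapRange_single]
  simp

namespace QuantumData

variable {k : Type u} [Field k] (D : QuantumData k)

lemma exists_H_mul_xi_pow (a : Fin D.n → ℕ) (j : Fin D.t) (r : ℕ) :
    ∃ s : k, s ≠ 0 ∧ D.H a * D.xi j ^ r = s • D.H (a + Pi.single (D.inc j) (2 * r)) := by
  induction r with
  | zero => exact ⟨1, one_ne_zero, by simp⟩
  | succ r ih =>
    obtain ⟨s, hs, h⟩ := ih
    refine ⟨_, mul_ne_zero hs (D.xiCoeff_ne_zero j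
      (a + Pi.single (D.inc j) (2 * r) + Pi.single (D.inc j) 2)), ?_⟩
    rw [pow_succ, ← mul_assoc, h, smul_mul_assoc, H_mul_xi, smul_smul, add_assoc,
      ← Pi.single_add, mul_add_one]

lemma exists_H_mul_prod_xi (b : Fin D.t → ℕ) (L : List (Fin D.t)) (a : Fin D.n → ℕ) :
    ∃ s : k, s ≠ 0 ∧ D.H a * (L.map fun j => D.xi j ^ b j).prod =
      s • D.H (a + (L.map fun j => Pi.single (D.inc j) (2 * b j)).sum) := by
  induction L generalizing a with
  | nil => exact ⟨1, one_ne_zero, by simp⟩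
  | cons j L ih =>
    obtain ⟨s, hs, h⟩ := D.exists_H_mul_xi_pow a j (b j)
    obtain ⟨s', hs', h'⟩ := ih (a + Pi.single (D.inc j) (2 * b j))
    refine ⟨s * s', mul_ne_zero hs hs', ?_⟩
    rw [List.map_cons, List.prod_cons, ← mul_assoc, h, smul_mul_assoc, h', smul_smul,
      List.map_cons, List.sum_cons, add_assoc]

lemma exists_H_mul_eta_pow {a : Fin D.n → ℕ} {i : Fin D.n} (ha : Even (a i)) (c : Fin 2) :
    ∃ s : k, s ≠ 0 ∧ D.H a * D.eta i ^ (c : ℕ) = s • D.H (a + Pi.single i (c : ℕ)) := by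
  obtain rfl | rfl : c = 0 ∨ c = 1 := by omega
  · exact ⟨1, one_ne_zero, by simp⟩
  · exact ⟨_, D.etaCoeff_ne_zero i _, (congrArg _ (pow_one _)).trans (D.H_mul_eta_of_even ha)⟩

/-- An even entry makes σ_i(a_i+1) = 1, so the scalar of η_i is nonzero; distinctness of the list
keeps the remaining entries even. -/
lemma exists_H_mul_prod_eta (c : Fin D.n → Fin 2) (L : List (Fin D.n)) (hL : L.Nodup)
    (a : Fin D.n → ℕ) (ha : ∀ i ∈ L, Even (a i)) :
    ∃ s : k, s ≠ 0 ∧ D.H a * (L.map fun i => D.eta i ^ (c i : ℕ)).prod =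
      s • D.H (a + (L.map fun i => Pi.single i (c i : ℕ)).sum) := by
  induction L generalizing a with
  | nil => exact ⟨1, one_ne_zero, by simp⟩
  | cons i L ih =>
    rw [List.nodup_cons] at hL
    obtain ⟨s, hs, h⟩ := D.exists_H_mul_eta_pow (ha i List.mem_cons_self) (c i)
    obtain ⟨s', hs', h'⟩ := ih hL.2 (a + Pi.single i (c i : ℕ)) fun j hj => by
      have : j ≠ i := fun e => hL.1 (e ▸ hj)
      simpa [this] using ha j (List.mem_cons_of_mem _ hj)
    refine ⟨s * s', mul_ne_zero hs hs', ?_⟩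
    rw [List.map_cons, List.prod_cons, ← mul_assoc, h, smul_mul_assoc, h', smul_smul,
      List.map_cons, List.sum_cons, add_assoc]

/-- The tuple `(2 b + c)` of the generator dual to the monomial with exponents `b` and `c`. -/
def exponent (b : Fin D.t → ℕ) (c : Fin D.n → Fin 2) (i : Fin D.n) : ℕ :=
  (if h : (i : ℕ) < D.t then 2 * b ⟨i, h⟩ else 0) + c i

lemma sum_single_inc (b : Fin D.t → ℕ) (i : Fin D.n) :
    (∑ j, Pi.single (D.inc j) (b j) : Fin D.n → ℕ) i =
      if h : (i : ℕ) < D.t then b ⟨i, h⟩ else 0 := by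
  rw [Finset.sum_apply]
  split_ifs with h
  · rw [Finset.sum_eq_single ⟨i, h⟩]
    · rw [inc_mk, Pi.single_eq_same]
    · intro j _ hj
      refine Pi.single_eq_of_ne (fun e => hj ?_) _
      exact D.inc_injective e.symm
    · simp
  · refine Finset.sum_eq_zero fun j _ => Pi.single_eq_of_ne (fun e => h ?_) _
    rw [e]
    exact j.2

/-- Starting from 1, the ξ factors contribute only even entries, so each later η_i meets an even
entry and no scalar vanishes. -/
theorem exists_monomial_eq (b : Fin D.t → ℕ) (c : Fin D.n → Fin 2) :
    ∃ s : k, s ≠ 0 ∧ monomial D.xi D.eta b c = s • D.H (D.exponent b c) := by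
  obtain ⟨s, hs, h⟩ := D.exists_H_mul_prod_xi b (List.finRange D.t) 0
  obtain ⟨s', hs', h'⟩ := D.exists_H_mul_prod_eta c (List.finRange D.n) (List.nodup_finRange _)
    (0 + ((List.finRange D.t).map fun j => Pi.single (D.inc j) (2 * b j)).sum) fun i _ => by
      rw [← List.ofFn_eq_map, List.sum_ofFn, zero_add, sum_single_inc]
      split_ifs <;> simp
  refine ⟨s * s', mul_ne_zero hs hs', ?_⟩
  rw [monomial, List.ofFn_eq_map, List.ofFn_eq_map, ← one_mul (List.prod _), ← H_zero, h,
    smul_mul_assoc, h', smul_smul]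
  congr 2
  ext i
  rw [← List.ofFn_eq_map, List.sum_ofFn, ← List.ofFn_eq_map, List.sum_ofFn, zero_add,
    Pi.add_apply, sum_single_inc, exponent]
  simp

/-- Finiteness makes the delta functions a basis of all functions on the generators. -/
instance finite_index (m : ℕ) : Finite (D.Index m) := by
  refine Finite.of_injective (β := Fin D.n → Fin (m + 1)) (fun a i => ⟨a.tuple i, ?_⟩) ?_
  · have := Finset.single_le_sum (f := a.tuple) (fun _ _ => Nat.zero_le _) (Finset.mem_univ i)
    have := a.isIndex.2
    omega
  · intro a b h
    refine Subtype.ext (funext fun i => ?_)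
    exact congrArg Fin.val (congrFun h i)

/-- The basis of `Ext^m(k, k)` dual to the generators of `K_m`. -/
def extBasis (m : ℕ) : Module.Basis (D.Index m) k (ExtAlgebra.Comp D.trivialModule m) :=
  (Pi.basisFun k (D.Index m)).map (LinearEquiv.ofBijective _ (D.extLinear_bijective m))

lemma extBasis_apply {m : ℕ} (a : D.Index m) : D.extBasis m a = D.cls m a.tuple := by
  classical
  rw [extBasis, Module.Basis.map_apply, Pi.basisFun_apply, cls]
  change D.extOf m _ = _
  congr 1
  ext b
  rw [Pi.single_apply]
  exact if_congr Subtype.ext_iff rfl rfl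

/-- The basis of the cohomology algebra dual to the generators of the resolution. -/
def cohomologyBasis : Module.Basis (Σ m, D.Index m) k D.Cohomology :=
  DFinsupp.basis D.extBasis

lemma cohomologyBasis_apply {m : ℕ} (a : D.Index m) : D.cohomologyBasis ⟨m, a⟩ = D.H a.tuple := by
  have h : D.cohomologyBasis ⟨m, a⟩ = D.homog m (D.extBasis m a) :=
    DFinsupp.basis_apply D.extBasis ⟨m, a⟩
  rw [h, extBasis_apply, homog_cls D a.isIndex.2]

lemma isIndex_exponent (b : Fin D.t → ℕ) (c : Fin D.n → Fin 2) :
    D.IsIndex (∑ i, D.exponent b c i) (D.exponent b c) := by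
  refine ⟨fun i hi => ?_, rfl⟩
  rw [exponent, dif_neg hi.not_gt]
  omega

/-- This is division with remainder by 2 in each entry; for i > t the entry is at most 1, so no
quotient is needed. -/
lemma bijective_exponent : Function.Bijective fun p : (Fin D.t → ℕ) × (Fin D.n → Fin 2) =>
    (⟨_, (D.isIndex_exponent p.1 p.2).index⟩ : Σ m, D.Index m) := by
  constructor
  · rintro ⟨b, c⟩ ⟨b', c'⟩ h
    have h1 : D.exponent b c = D.exponent b' c' :=
      congrArg (fun x : Σ m, D.Index m => x.2.tuple) h
    have hc : c = c' := by
      ext i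
      have := congrFun h1 i
      simp only [exponent] at this
      split_ifs at this <;> omega
    subst hc
    congr 1
    ext j
    have := congrFun h1 (D.inc j)
    simp only [exponent, add_left_inj] at this
    have hj : (D.inc j : ℕ) < D.t := j.2
    rw [dif_pos hj, dif_pos hj] at this
    exact Nat.eq_of_mul_eq_mul_left two_pos this
  · rintro ⟨m, a⟩
    refine ⟨(fun j => a.tuple (D.inc j) / 2, fun i => ⟨a.tuple i % 2, Nat.mod_lt _ two_pos⟩), ?_⟩
    have h : D.exponent (fun j => a.tuple (D.inc j) / 2)
        (fun i => ⟨a.tuple i % 2, Nat.mod_lt _ two_pos⟩) = a.tuple := by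
      ext i
      rw [exponent]
      split_ifs with hi
      · rw [inc_mk]
        exact Nat.div_add_mod _ _
      · have := a.isIndex.1 i (not_lt.mp hi)
        simp only
        omega
    -- Degree and tuple are generalized together, because the degree occurs in the type of the
    -- index.
    have key : ∀ {e : Fin D.n → ℕ} {r : ℕ} (he : D.IsIndex r e), e = a.tuple →
        (⟨r, he.index⟩ : Σ m, D.Index m) = ⟨m, a⟩ := by
      rintro e r he rfl
      obtain rfl : r = m := he.2.symm.trans a.isIndex.2
      rfl
    exact key _ h

/-- The basis of ordered monomials. -/
def monomialBasis : Module.Basis ((Fin D.t → ℕ) × (Fin D.n → Fin 2)) k D.Cohomology :=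
  (D.cohomologyBasis.reindex (Equiv.ofBijective _ D.bijective_exponent).symm).unitsSMul
    fun p => Units.mk0 _ (D.exists_monomial_eq p.1 p.2).choose_spec.1

lemma monomialBasis_apply (b : Fin D.t → ℕ) (c : Fin D.n → Fin 2) :
    D.monomialBasis (b, c) = monomial D.xi D.eta b c := by
  rw [monomialBasis, Module.Basis.unitsSMul_apply, Module.Basis.reindex_apply, Equiv.symm_symm,
    Equiv.ofBijective_apply, cohomologyBasis_apply, IsIndex.tuple_index]
  exact (D.exists_monomial_eq b c).choose_spec.2.symm

lemma monomial_mem {B : Subalgebra k D.Cohomology} (hxi : ∀ j, D.xi j ∈ B) (heta : ∀ i, D.eta i ∈ B)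
    (b : Fin D.t → ℕ) (c : Fin D.n → Fin 2) : monomial D.xi D.eta b c ∈ B := by
  refine mul_mem (list_prod_mem fun y hy => ?_) (list_prod_mem fun y hy => ?_)
  · obtain ⟨j, rfl⟩ := List.mem_ofFn.mp hy
    exact pow_mem (hxi j) _
  · obtain ⟨i, rfl⟩ := List.mem_ofFn.mp hy
    exact pow_mem (heta i) _

lemma subalgebra_eq_top {B : Subalgebra k D.Cohomology} (hxi : ∀ j, D.xi j ∈ B)
    (heta : ∀ i, D.eta i ∈ B) : B = ⊤ := by
  rw [← Algebra.toSubmodule_eq_top, eq_top_iff, ← D.monomialBasis.span_eq, Submodule.span_le]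
  rintro _ ⟨⟨b, c⟩, rfl⟩
  rw [monomialBasis_apply]
  exact D.monomial_mem hxi heta b c

theorem adjoin_eq_top :
    Algebra.adjoin k (Set.range D.xi ∪ Set.range D.eta) = ⊤ :=
  D.subalgebra_eq_top (fun j => Algebra.subset_adjoin (Or.inl ⟨j, rfl⟩))
    fun i => Algebra.subset_adjoin (Or.inr ⟨i, rfl⟩)

end QuantumData

/-! ### The presentation of the cohomology algebra -/

namespace QuantumData

variable {k : Type u} [Field k] (D : QuantumData k) (c : Fin D.t → k)

/-- The generator `ξ_j` of the presented algebra. -/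
def genXi (j : Fin D.t) : RingQuot (D.CohRel c) :=
  RingQuot.mkAlgHom k (D.CohRel c) (FreeAlgebra.ι k (Sum.inl j))

/-- The generator `η_i` of the presented algebra. -/
def genEta (i : Fin D.n) : RingQuot (D.CohRel c) :=
  RingQuot.mkAlgHom k (D.CohRel c) (FreeAlgebra.ι k (Sum.inr i))

lemma genXi_mul_genXi (i j : Fin D.t) : D.genXi c i * D.genXi c j =
    D.q (D.inc j) (D.inc i) ^ (D.N i * D.N j) • (D.genXi c j * D.genXi c i) := by
  simpa [genXi] using RingQuot.mkAlgHom_rel k (CohRel.xi_xi (c := c) i j)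

lemma genEta_mul_genXi (i : Fin D.n) (j : Fin D.t) : D.genEta c i * D.genXi c j =
    D.q (D.inc j) i ^ D.N j • (D.genXi c j * D.genEta c i) := by
  simpa [genXi, genEta] using RingQuot.mkAlgHom_rel k (CohRel.eta_xi (c := c) i j)

lemma genEta_mul_genEta {i j : Fin D.n} (h : i ≠ j) : D.genEta c i * D.genEta c j =
    -D.q j i • (D.genEta c j * D.genEta c i) := by
  simpa [genEta, -neg_smul] using RingQuot.mkAlgHom_rel k (CohRel.eta_eta (c := c) i j h)

lemma genEta_sq_eq_zero {i : Fin D.n} (h : ∀ j, D.inc j = i → D.N j ≠ 2) :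
    D.genEta c i ^ 2 = 0 := by
  simpa [genEta] using RingQuot.mkAlgHom_rel k (CohRel.eta_sq_zero (c := c) i h)

lemma genEta_sq_eq {j : Fin D.t} (h : D.N j = 2) :
    D.genEta c (D.inc j) ^ 2 = c j • D.genXi c j := by
  simpa [genXi, genEta] using RingQuot.mkAlgHom_rel k (CohRel.eta_sq (c := c) j h)

/-- The span of the ordered monomials in the presented algebra. -/
def monomialSpan : Submodule k (RingQuot (D.CohRel c)) :=
  Submodule.span k (Set.range fun p : (Fin D.t → ℕ) × (Fin D.n → Fin 2) =>
    orderedMonomial (D.genXi c) p.1 * orderedMonomial (D.genEta c) fun i => (p.2 i : ℕ))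

lemma mem_monomialSpan (b : Fin D.t → ℕ) {e : Fin D.n → ℕ} (he : ∀ i, e i ≤ 1) :
    orderedMonomial (D.genXi c) b * orderedMonomial (D.genEta c) e ∈ D.monomialSpan c :=
  Submodule.subset_span ⟨(b, fun i => ⟨e i, Nat.lt_succ_of_le (he i)⟩), rfl⟩

lemma mul_genXi_mem (b : Fin D.t → ℕ) {e : Fin D.n → ℕ} (he : ∀ i, e i ≤ 1) (j : Fin D.t) :
    orderedMonomial (D.genXi c) b * orderedMonomial (D.genEta c) e * D.genXi c j ∈
      D.monomialSpan c := by
  rw [mul_assoc, orderedMonomial_mul _ _ _ (fun i => D.genEta_mul_genXi c i j), mul_smul_comm,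
    ← mul_assoc, orderedMonomial_mul_self _ (fun l j => D.q (D.inc j) (D.inc l) ^ (D.N l * D.N j))
      (fun j l _ => D.genXi_mul_genXi c l j), smul_mul_assoc]
  exact Submodule.smul_mem _ _ (Submodule.smul_mem _ _ (D.mem_monomialSpan c _ he))

lemma orderedMonomial_genEta_mul (e : Fin D.n → ℕ) (i : Fin D.n) :
    ∃ s : k, s ≠ 0 ∧ orderedMonomial (D.genEta c) e * D.genEta c i =
      s • orderedMonomial (D.genEta c) (e + Pi.single i 1) :=
  ⟨_, Finset.prod_ne_zero_iff.mpr fun l _ => pow_ne_zero _ (neg_ne_zero.mpr (D.q_ne_zero i l)),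
    orderedMonomial_mul_self _ (fun l j => -D.q j l)
      (fun _ _ h => D.genEta_mul_genEta c h.ne') e i⟩

/-- If η_i is absent it is inserted in its place. If present, it is moved to the right end to form
η_i², which is zero or a multiple of ξ_j, and `mul_genXi_mem` finishes. -/
lemma mul_genEta_mem (b : Fin D.t → ℕ) {e : Fin D.n → ℕ} (he : ∀ i, e i ≤ 1) (i : Fin D.n) :
    orderedMonomial (D.genXi c) b * orderedMonomial (D.genEta c) e * D.genEta c i ∈
      D.monomialSpan c := by
  by_cases hi : e i = 0
  · obtain ⟨s, _, h⟩ := D.orderedMonomial_genEta_mul c e i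
    rw [mul_assoc, h, mul_smul_comm]
    refine Submodule.smul_mem _ _ (D.mem_monomialSpan c _ fun l => ?_)
    by_cases hl : l = i
    · subst hl
      simp [hi]
    · simpa [hl] using he l
  · have he' : ∀ l, (e - Pi.single i 1 : Fin D.n → ℕ) l ≤ 1 := fun l =>
      (Nat.sub_le _ _).trans (he l)
    obtain ⟨s, hs, h⟩ := D.orderedMonomial_genEta_mul c (e - Pi.single i 1) i
    rw [sub_single_add_single (Nat.one_le_iff_ne_zero.mpr hi), ← inv_smul_eq_iff₀ hs] at h
    rw [← h, mul_smul_comm, smul_mul_assoc, mul_assoc, mul_assoc, ← sq, ← mul_assoc]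
    refine Submodule.smul_mem _ _ ?_
    by_cases h0 : ∀ j, D.inc j = i → D.N j ≠ 2
    · rw [genEta_sq_eq_zero D c h0, mul_zero]
      exact Submodule.zero_mem _
    · push Not at h0
      obtain ⟨j, rfl, hj⟩ := h0
      rw [genEta_sq_eq D c hj, mul_smul_comm]
      exact Submodule.smul_mem _ _ (D.mul_genXi_mem c b he' j)

theorem monomialSpan_eq_top : D.monomialSpan c = ⊤ := by
  refine Submodule.eq_top_of_mul_mem (RingQuot.adjoin_range_mkAlgHom_ι (D.CohRel c)) _ ?_ ?_
  · have := D.mem_monomialSpan c 0 (e := 0) (by simp)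
    rwa [orderedMonomial_zero, orderedMonomial_zero, mul_one] at this
  · rintro _ ⟨g, rfl⟩ w hw
    induction hw using Submodule.span_induction with
    | zero => rw [zero_mul]; exact Submodule.zero_mem _
    | add v w _ _ hv hw => rw [add_mul]; exact Submodule.add_mem _ hv hw
    | smul s w _ hw => rw [smul_mul_assoc]; exact Submodule.smul_mem _ _ hw
    | mem w hw =>
      obtain ⟨⟨b, e⟩, rfl⟩ := hw
      rcases g with j | i
      · exact D.mul_genXi_mem c b (fun i => Nat.le_of_lt_succ (e i).2) j
      · exact D.mul_genEta_mem c b (fun i => Nat.le_of_lt_succ (e i).2) i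

/-- The map from the presented algebra to the cohomology algebra. -/
def presentation : RingQuot (D.CohRel fun _ => -1) →ₐ[k] D.Cohomology :=
  RingQuot.liftAlgHom k ⟨FreeAlgebra.lift k (Sum.elim D.xi D.eta), by
    intro x y h
    cases h with
    | xi_xi i j => simpa using D.xi_mul_xi i j
    | eta_xi i j => simpa using D.eta_mul_xi i j
    | eta_eta i j h => simpa using D.eta_mul_eta h
    | eta_sq_zero i h => simpa using D.eta_sq_eq_zero h
    | eta_sq j h => simpa using D.eta_sq_eq h⟩

lemma presentation_genXi (j : Fin D.t) : D.presentation (D.genXi _ j) = D.xi j := by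
  simp [presentation, genXi]

lemma presentation_genEta (i : Fin D.n) : D.presentation (D.genEta _ i) = D.eta i := by
  simp [presentation, genEta]

lemma presentation_monomial (b : Fin D.t → ℕ) (e : Fin D.n → Fin 2) :
    D.presentation (orderedMonomial (D.genXi _) b *
      orderedMonomial (D.genEta _) fun i => (e i : ℕ)) = D.monomialBasis (b, e) := by
  rw [monomialBasis_apply, monomial, map_mul, orderedMonomial, orderedMonomial, map_list_prod,
    map_list_prod, List.map_ofFn, List.map_ofFn]
  congr 3
  · ext j
    rw [Function.comp_apply, map_pow, presentation_genXi]
  · ext i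
    rw [Function.comp_apply, map_pow, presentation_genEta]

/-- A spanning family mapped to a linearly independent one forces injectivity; surjectivity is
generation by the ξ_j and η_i. -/
lemma presentation_bijective : Function.Bijective D.presentation := by
  constructor
  · refine LinearMap.injective_of_linearIndependent (f := D.presentation.toLinearMap)
      (D.monomialSpan_eq_top _) ?_
    have h : D.presentation.toLinearMap ∘ (fun p : (Fin D.t → ℕ) × (Fin D.n → Fin 2) =>
        orderedMonomial (D.genXi _) p.1 * orderedMonomial (D.genEta _) fun i => (p.2 i : ℕ)) =
          D.monomialBasis := funext fun p => D.presentation_monomial p.1 p.2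
    rw [h]
    exact D.monomialBasis.linearIndependent
  · rw [← AlgHom.range_eq_top]
    exact D.subalgebra_eq_top (fun j => ⟨_, D.presentation_genXi j⟩)
      fun i => ⟨_, D.presentation_genEta i⟩

end QuantumData

end

theorem mainTheorem2 {k : Type u} [Field k] (D : QuantumData k) :
    ∃ (K : D.TwistedResolution)
      (ξ : Fin D.t → ExtAlgebra.Comp D.trivialModule 2)
      (η : Fin D.n → ExtAlgebra.Comp D.trivialModule 1)
      (c : Fin D.t → k),
      -- `ξ_j` and `η_i` are dual to `Φ(0, …, 2, …, 0)` and `Φ(0, …, 1, …, 0)`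
      (∀ j, K.IsDualClass (Pi.single (D.inc j) 2) (ξ j)) ∧
      (∀ i, K.IsDualClass (Pi.single i 1) (η i)) ∧
      -- generation
      Algebra.adjoin k (Set.range (fun j => D.homog 2 (ξ j)) ∪
        Set.range (fun i => D.homog 1 (η i))) = ⊤ ∧
      -- relations
      (∀ i j, D.homog 2 (ξ i) * D.homog 2 (ξ j) =
        D.q (D.inc j) (D.inc i) ^ (D.N i * D.N j) • (D.homog 2 (ξ j) * D.homog 2 (ξ i))) ∧
      (∀ i j, D.homog 1 (η i) * D.homog 2 (ξ j) =
        D.q (D.inc j) i ^ D.N j • (D.homog 2 (ξ j) * D.homog 1 (η i))) ∧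
      (∀ i j, i ≠ j → D.homog 1 (η i) * D.homog 1 (η j) =
        -D.q j i • (D.homog 1 (η j) * D.homog 1 (η i))) ∧
      (∀ i, (∀ j, D.inc j = i → D.N j ≠ 2) → D.homog 1 (η i) ^ 2 = 0) ∧
      (∀ j, c j ≠ 0) ∧
      (∀ j, D.N j = 2 → D.homog 1 (η (D.inc j)) ^ 2 = c j • D.homog 2 (ξ j)) ∧
      -- these relations present the algebra
      (∃ e : RingQuot (D.CohRel c) ≃ₐ[k] D.Cohomology,
        (∀ j, e (RingQuot.mkAlgHom k (D.CohRel c) (FreeAlgebra.ι k (Sum.inl j))) =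
          D.homog 2 (ξ j)) ∧
        (∀ i, e (RingQuot.mkAlgHom k (D.CohRel c) (FreeAlgebra.ι k (Sum.inr i))) =
          D.homog 1 (η i))) ∧
      -- the ordered monomials form a basis
      (∃ B : Module.Basis ((Fin D.t → ℕ) × (Fin D.n → Fin 2)) k D.Cohomology,
        ∀ b e, B (b, e) = QuantumData.monomial (fun j => D.homog 2 (ξ j))
          (fun i => D.homog 1 (η i)) b e) := by
  -- The value c_j = -1 is the scalar found in `eta_sq`; for N_j ≠ 2 any nonzero value would serve.
  exact ⟨D.twistedResolution, fun j => D.cls 2 (Pi.single (D.inc j) 2),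
    fun i => D.cls 1 (Pi.single i 1), fun _ => -1, fun j => D.isDualClass_cls 2 _,
    fun i => D.isDualClass_cls 1 _, D.adjoin_eq_top, D.xi_mul_xi, D.eta_mul_xi,
    fun i j h => D.eta_mul_eta h, fun i h => D.eta_sq_eq_zero h,
    fun _ => neg_ne_zero.mpr one_ne_zero, fun j h => D.eta_sq_eq h,
    ⟨AlgEquiv.ofBijective D.presentation D.presentation_bijective, D.presentation_genXi,
      D.presentation_genEta⟩, ⟨D.monomialBasis, D.monomialBasis_apply⟩⟩
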